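/- Let $X$ be a Polish space, let $d\in\mathbb N$, and let $G$ be a $d$-regular bipartite Borel graph on $X$, i.e. a simple graph with vertex set $X$ whose edge relation is a Borel subset of $X\times X$, all of whose vertices have degree $d$, and which admits a (not necessarily Borel) proper $2$-coloring. Suppose that $G$ is one-ended: for every connected component $C$ of $G$ and every finite $F\subseteq C$, the subgraph of $G$ induced on $C\setminus F$ has exactly one infinite connected component. Then $G$ has a Borel perfect matching generically: there is a comeagre Borel set $Y\subseteq X$ that is $G$-invariant (a union of connected components of $G$), together with a perfect matching $M$ of the induced subgraph $G|_Y$ (a set of edges of $G|_Y$ such that every vertex of $Y$ lies in exactly one of them) whose edge relation is a Borel subset of $Y\times Y$. -/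

import Mathlib

/-- A Borel graph: the edge relation is a Borel subset of `X × X`. -/
def SimpleGraph.IsBorel {X : Type*} [MeasurableSpace X] (G : SimpleGraph X) : Prop :=
  MeasurableSet {p : X × X | G.Adj p.1 p.2}

/-- One-endedness of a connected graph: deleting any finite set of vertices leaves exactly one
infinite connected component. -/
def SimpleGraph.HasOneEnd {V : Type*} (H : SimpleGraph V) : Prop :=
  ∀ F : Set V, F.Finite → ∃! D : (H.induce Fᶜ).ConnectedComponent, D.supp.Infinite

/-- A graph, connected or not, is one-ended if each of its connected components is. -/
def SimpleGraph.IsOneEnded {V : Type*} (G : SimpleGraph V) : Prop :=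
  ∀ C : G.ConnectedComponent, C.toSimpleGraph.HasOneEnd

/-- A `G`-invariant set of vertices: a union of connected components of `G`. -/
def SimpleGraph.IsInvariantSet {V : Type*} (G : SimpleGraph V) (Y : Set V) : Prop :=
  ∀ ⦃x y : V⦄, G.Reachable x y → x ∈ Y → y ∈ Y

/-- A Borel perfect matching of `G`: a perfect matching whose edge relation is Borel. -/
def SimpleGraph.HasBorelPerfectMatching {X : Type*} [MeasurableSpace X]
    (G : SimpleGraph X) : Prop :=
  ∃ M : G.Subgraph, M.IsPerfectMatching ∧ MeasurableSet {p : X × X | M.Adj p.1 p.2}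

/-!
The uniform fractional perfect matching of a regular graph is rounded to an integral one by
successive Borel refinements, none of which changes a weight that is already integral.

A signed count of weights over the two colour classes, modulo the degree, shows that no finite set
of vertices has exactly one fractional edge leaving it; by one-endedness no fractional edge is then
a bridge. So every fractional edge lies on a cycle of fractional edges, and alternately raising and
lowering the weights along such cycles makes the matching integral at any given vertex after
finitely many changes. These changes can be made simultaneously inside disjoint finite windows,
chosen so that the exits of a window stay connected inside it; the graph of fractional edges then
remains one-ended up to finite components, and the rounding can continue.

Countably many Borel families of windows take care of every vertex. Hence, for a given nonempty open
set, one of them makes the matching integral at nonmeagrely many of its vertices, and going through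
a countable basis gives a sequence of refinements that is eventually integral at every vertex of a
comeagre set, and indeed at all vertices of the components of a comeagre set of vertices.
-/

open Set

section Ends

variable {V : Type*} {G H H' : SimpleGraph V}

/-- A graph has at most one end if deleting any finite set of vertices leaves at most one infinite
connected component. -/
def HasAtMostOneEnd (H : SimpleGraph V) : Prop :=
  ∀ F : Set V, F.Finite →
    {D : (H.induce Fᶜ).ConnectedComponent | D.supp.Infinite}.Subsingleton

theorem HasAtMostOneEnd.of_hasOneEnd (h : H.HasOneEnd) : HasAtMostOneEnd H :=
  fun F hF _ hD _ hE => (h F hF).unique hD hE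

theorem exists_infinite_supp_of_infinite [H.LocallyFinite] (hH : H.Preconnected) {F A : Set V}
    (hF : F.Finite) (hA : A.Infinite) :
    ∃ D : (H.induce Fᶜ).ConnectedComponent, D.supp.Infinite ∧ ∃ v ∈ D.supp, (v : V) ∈ A := by
  have : Fact H.Preconnected := ⟨hH⟩
  lift F to Finset V using hF
  have : Finite (H.induce (F : Set V)ᶜ).ConnectedComponent := H.componentCompl_finite F
  have : Infinite (A \ F : Set V) := (hA.sdiff F.finite_toSet).to_subtype
  let outside : (A \ F : Set V) → ((F : Set V)ᶜ : Set V) := fun v => ⟨v, v.2.2⟩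
  have outside_injective : outside.Injective := fun u v huv =>
    Subtype.ext (by simpa [outside] using huv)
  obtain ⟨D, hD⟩ := Finite.exists_infinite_fiber
    fun v => (H.induce (F : Set V)ᶜ).connectedComponentMk (outside v)
  obtain ⟨v, hv⟩ := (Set.infinite_coe_iff.1 hD).nonempty
  refine ⟨D, ?_, outside v, hv, v.2.1⟩
  refine ((Set.infinite_coe_iff.1 hD).image outside_injective.injOn).mono ?_
  rintro _ ⟨w, hw, rfl⟩
  exact hw

theorem HasAtMostOneEnd.finite_or_finite_compl [H.LocallyFinite] (hend : HasAtMostOneEnd H)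
    (hH : H.Preconnected) {S : Set V}
    (hS : {p : V × V | H.Adj p.1 p.2 ∧ p.1 ∈ S ∧ p.2 ∉ S}.Finite) : S.Finite ∨ Sᶜ.Finite := by
  by_contra! hinf
  set F := Prod.fst '' {p : V × V | H.Adj p.1 p.2 ∧ p.1 ∈ S ∧ p.2 ∉ S}
  have hFfin : F.Finite := hS.image _
  obtain ⟨D, hD, u, huD, huS⟩ := exists_infinite_supp_of_infinite hH hFfin hinf.1
  obtain ⟨E, hE, v, hvE, hvS⟩ := exists_infinite_supp_of_infinite hH hFfin hinf.2
  obtain rfl : D = E := hend F hFfin hD hE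
  obtain ⟨walk⟩ := SimpleGraph.ConnectedComponent.exact (huD.trans hvE.symm)
  obtain ⟨e, -, heS, heS'⟩ := walk.exists_boundary_dart (Subtype.val ⁻¹' S) huS hvS
  exact e.fst.2 ⟨(e.fst, e.snd), ⟨e.adj, heS, heS'⟩, rfl⟩

theorem infinite_of_hasOneEnd (h : H.HasOneEnd) : Infinite V := by
  obtain ⟨D, hD, -⟩ := h ∅ Set.finite_empty
  exact Set.infinite_univ_iff.1 ((hD.image Subtype.val_injective.injOn).mono (subset_univ _))

theorem degree_ne_zero_of_isOneEnded [G.LocallyFinite] (hG : G.IsOneEnded) (x : V) :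
    G.degree x ≠ 0 := by
  set C := G.connectedComponentMk x
  have : Infinite C := infinite_of_hasOneEnd (hG C)
  obtain ⟨y, hxy⟩ := exists_ne (⟨x, rfl⟩ : C)
  obtain ⟨walk⟩ : G.Reachable x y := (SimpleGraph.ConnectedComponent.exact y.2).symm
  have hnil : ¬ walk.Nil := fun h => hxy (Subtype.ext h.eq.symm)
  exact ((G.degree_pos_iff_exists_adj x).2 ⟨_, walk.adj_snd hnil⟩).ne'

/-- One-endedness of a spanning subgraph `H` of `G`, up to finite components: within each connected
component of `G`, a set with finite edge boundary in `H` contains or misses all but finitely many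
of the vertices with infinite `H`-component. -/
def AlmostOneEnded (G H : SimpleGraph V) : Prop :=
  ∀ (x : V) (S : Set V),
    {p : V × V | G.Reachable x p.1 ∧ H.Adj p.1 p.2 ∧ p.1 ∈ S ∧ p.2 ∉ S}.Finite →
    {v | G.Reachable x v ∧ {w | H.Reachable v w}.Infinite ∧ v ∈ S}.Finite ∨
    {v | G.Reachable x v ∧ {w | H.Reachable v w}.Infinite ∧ v ∉ S}.Finite

theorem AlmostOneEnded.self [G.LocallyFinite]
    (hend : ∀ C : G.ConnectedComponent, HasAtMostOneEnd C.toSimpleGraph) :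
    AlmostOneEnded G G := by
  intro x S hS
  let C := G.connectedComponentMk x
  have : C.toSimpleGraph.LocallyFinite := fun v =>
    Fintype.ofInjective (fun w : C.toSimpleGraph.neighborSet v =>
      (⟨(w : C), w.2⟩ : G.neighborSet v)) fun _ _ h =>
        Subtype.ext (Subtype.ext (Subtype.mk.inj h))
  have mem_C : ∀ {v}, G.Reachable x v ↔ v ∈ C.supp := fun {v} =>
    ⟨fun h => SimpleGraph.ConnectedComponent.sound h.symm,
      fun h => (SimpleGraph.ConnectedComponent.exact h).symm⟩
  have hboundary : {p : C × C | C.toSimpleGraph.Adj p.1 p.2 ∧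
      p.1 ∈ (Subtype.val ⁻¹' S : Set C) ∧ p.2 ∉ (Subtype.val ⁻¹' S : Set C)}.Finite :=
    (hS.preimage (f := Prod.map Subtype.val Subtype.val)
      (Subtype.val_injective.prodMap Subtype.val_injective).injOn).subset
      fun p hp => ⟨mem_C.2 p.1.2, hp⟩
  refine ((hend C).finite_or_finite_compl C.connected_toSimpleGraph.preconnected hboundary).imp
    (fun hfin => (hfin.image Subtype.val).subset ?_)
    (fun hfin => (hfin.image Subtype.val).subset ?_) <;>
  · rintro v ⟨hv, -, hvS⟩
    exact ⟨⟨v, mem_C.1 hv⟩, hvS, rfl⟩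

theorem AlmostOneEnded.bot (G : SimpleGraph V) : AlmostOneEnded G ⊥ :=
  fun _ _ _ => .inl <| finite_empty.subset fun v hv => hv.2.1 <|
    (finite_singleton v).subset fun _ hw => (SimpleGraph.reachable_bot.1 hw).symm

theorem AlmostOneEnded.mono_of_finite_diff (h : AlmostOneEnded G H) (hle : H' ≤ H)
    (hfin : {p : V × V | H.Adj p.1 p.2 ∧ ¬ H'.Adj p.1 p.2}.Finite) : AlmostOneEnded G H' := by
  intro x S hS
  have hinf : ∀ v, {w | H'.Reachable v w}.Infinite → {w | H.Reachable v w}.Infinite :=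
    fun v hv => hv.mono fun w hw => hw.mono hle
  have hboundary : {p : V × V | G.Reachable x p.1 ∧ H.Adj p.1 p.2 ∧ p.1 ∈ S ∧ p.2 ∉ S}.Finite := by
    refine (hS.union hfin).subset ?_
    rintro p ⟨hx, hadj, hp⟩
    by_cases hadj' : H'.Adj p.1 p.2
    · exact Or.inl ⟨hx, hadj', hp⟩
    · exact Or.inr ⟨hadj, hadj'⟩
  exact (h x S hboundary).imp (fun hf => hf.subset fun v hv => ⟨hv.1, hinf v hv.2.1, hv.2.2⟩)
    (fun hf => hf.subset fun v hv => ⟨hv.1, hinf v hv.2.1, hv.2.2⟩)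

theorem AlmostOneEnded.reachable (h : AlmostOneEnded G H) (hle : H ≤ G) {u v : V}
    (huv : G.Reachable u v) (hu : {w | H.Reachable u w}.Infinite)
    (hv : {w | H.Reachable v w}.Infinite) : H.Reachable u v := by
  by_contra hnot
  have hinf : ∀ {a b}, H.Reachable a b → {w | H.Reachable a w}.Infinite →
      {w | H.Reachable b w}.Infinite := fun hab ha => ha.mono fun w hw => hab.symm.trans hw
  have hboundary : {p : V × V | G.Reachable u p.1 ∧ H.Adj p.1 p.2 ∧
      p.1 ∈ {w | H.Reachable u w} ∧ p.2 ∉ {w | H.Reachable u w}} = ∅ :=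
    Set.eq_empty_of_forall_notMem fun p hp => hp.2.2.2 (hp.2.2.1.trans hp.2.1.reachable)
  rcases h u {w | H.Reachable u w} (hboundary ▸ Set.finite_empty) with hf | hf
  · exact hu (hf.subset fun w hw => ⟨hw.mono hle, hinf hw hu, hw⟩)
  · exact hv (hf.subset fun w hw =>
      ⟨huv.trans (hw.mono hle), hinf hw hv, fun hw' => hnot (hw'.trans hw.symm)⟩)

theorem exists_finite_superset_induce_preconnected {I : Set V} (hIfin : I.Finite)
    (hI : ∀ u ∈ I, ∀ v ∈ I, H.Reachable u v) :
    ∃ Q : Set V, Q.Finite ∧ I ⊆ Q ∧ (H.induce Q).Preconnected ∧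
      ∀ q ∈ Q, ∃ u ∈ I, H.Reachable u q := by
  classical
  obtain rfl | ⟨base, hbase⟩ := I.eq_empty_or_nonempty
  · exact ⟨∅, finite_empty, subset_rfl, fun q => q.2.elim, by simp⟩
  let path (v : I) : H.Walk base v := (hI base hbase v v.2).some
  let Q : Set V := ⋃ v, {z | z ∈ (path v).support}
  have hsub : ∀ v, ∀ z ∈ (path v).support, z ∈ Q := fun v z hz => mem_iUnion.2 ⟨v, hz⟩
  have hbaseQ : base ∈ Q := hsub ⟨base, hbase⟩ base (path _).start_mem_support
  have hjoin : ∀ q : Q, (H.induce Q).Reachable ⟨base, hbaseQ⟩ q := by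
    rintro ⟨q, hq⟩
    obtain ⟨v, hqv⟩ := mem_iUnion.1 hq
    exact (((path v).takeUntil q hqv).induce Q fun z hz =>
      hsub v z ((path v).support_takeUntil_subset_support hqv hz)).reachable
  have : Finite I := hIfin
  refine ⟨Q, finite_iUnion fun v => List.finite_toSet _,
    fun v hv => hsub ⟨v, hv⟩ v (path _).end_mem_support,
    fun q q' => (hjoin q).symm.trans (hjoin q'), fun q hq => ?_⟩
  obtain ⟨v, hqv⟩ := mem_iUnion.1 hq
  exact ⟨base, hbase, ((path v).takeUntil q hqv).reachable⟩

theorem AlmostOneEnded.exists_finite_superset (h : AlmostOneEnded G H) (hle : H ≤ G) {x : V}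
    {W₀ : Set V} (hW₀fin : W₀.Finite) (hW₀ : ∀ w ∈ W₀, G.Reachable x w) :
    ∃ W : Set V, W.Finite ∧ W₀ ⊆ W ∧ (∀ w ∈ W, G.Reachable x w) ∧
      ∀ a b : W, (∃ t ∉ W, H.Adj a t) → (∃ t ∉ W, H.Adj b t) → (H.induce W).Reachable a b := by
  obtain ⟨Q, hQfin, hIQ, hQ, hQI⟩ := exists_finite_superset_induce_preconnected
    (I := {u ∈ W₀ | {w | H.Reachable u w}.Infinite}) (hW₀fin.sep _) fun u hu v hv =>
      h.reachable hle ((hW₀ u hu.1).symm.trans (hW₀ v hv.1)) hu.2 hv.2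
  let R : Set V := ⋃ u ∈ {u ∈ W₀ | {w | H.Reachable u w}.Finite}, {w | H.Reachable u w}
  have mem_R : ∀ {z}, z ∈ R ↔ ∃ u ∈ W₀, {w | H.Reachable u w}.Finite ∧ H.Reachable u z := by
    simp [R, and_assoc]
  have mem_Q_of_exit : ∀ a ∈ Q ∪ R, (∃ t ∉ Q ∪ R, H.Adj a t) → a ∈ Q := by
    rintro a ha ⟨t, ht, hat⟩
    refine ha.resolve_right fun haR => ht (Or.inr ?_)
    obtain ⟨u, hu, hfin, hua⟩ := mem_R.1 haR
    exact mem_R.2 ⟨u, hu, hfin, hua.trans hat.reachable⟩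
  refine ⟨Q ∪ R, hQfin.union ((hW₀fin.sep _).biUnion fun u hu => hu.2), fun u hu => ?_,
    fun w hw => ?_, fun a b ha hb => ?_⟩
  · by_cases hinf : {w | H.Reachable u w}.Infinite
    · exact Or.inl (hIQ ⟨hu, hinf⟩)
    · exact Or.inr (mem_R.2 ⟨u, hu, Set.not_infinite.1 hinf, .refl u⟩)
  · rcases hw with hw | hw
    · obtain ⟨u, hu, huw⟩ := hQI w hw
      exact (hW₀ u hu.1).trans (huw.mono hle)
    · obtain ⟨u, hu, -, huw⟩ := mem_R.1 hw
      exact (hW₀ u hu).trans (huw.mono hle)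
  · exact (hQ ⟨a, mem_Q_of_exit a a.2 ha⟩ ⟨b, mem_Q_of_exit b b.2 hb⟩).map
      (H.induceHomOfLE subset_union_left).toHom

theorem exists_sign_of_isBipartite (hbip : G.IsBipartite) (u : V) :
    ∃ sgn : V → ℤˣ, sgn u = 1 ∧ ∀ a b, G.Adj a b → sgn b = -sgn a := by
  obtain ⟨color⟩ := hbip
  refine ⟨fun a => if color a = color u then 1 else -1, if_pos rfl, fun a b hab => ?_⟩
  have hflip : color b = color u ↔ ¬ color a = color u := by
    have := color.valid hab
    omega
  by_cases ha : color a = color u <;> simp [hflip, ha]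

end Ends

section WalkFlow

variable {V : Type*} {G H : SimpleGraph V}

open scoped Classical in
/-- The unit flow along a walk: the number of traversals of the dart `(a, b)` minus the number of
traversals of the opposite dart `(b, a)`. -/
noncomputable def walkFlow {u v : V} (p : H.Walk u v) (a b : V) : ℤ :=
  (p.darts.map SimpleGraph.Dart.toProd).count (a, b) -
    (p.darts.map SimpleGraph.Dart.toProd).count (b, a)

theorem walkFlow_swap {u v : V} (p : H.Walk u v) (a b : V) :
    walkFlow p b a = -walkFlow p a b := by
  simp only [walkFlow, neg_sub]

theorem walkFlow_eq_zero {u v : V} (p : H.Walk u v) {a b : V} (h : s(a, b) ∉ p.edges) :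
    walkFlow p a b = 0 := by
  classical
  have hnot : ∀ c e, s(c, e) = s(a, b) →
      (c, e) ∉ p.darts.map SimpleGraph.Dart.toProd := by
    rintro c e hce hmem
    obtain ⟨dart, hdart, heq⟩ := List.mem_map.1 hmem
    refine h (hce ▸ List.mem_map.2 ⟨dart, hdart, ?_⟩)
    rw [SimpleGraph.Dart.edge, heq]
  simp only [walkFlow, List.count_eq_zero_of_not_mem (hnot a b rfl),
    List.count_eq_zero_of_not_mem (hnot b a Sym2.eq_swap), sub_self]

theorem abs_walkFlow_le_one {u v : V} {p : H.Walk u v} (hp : p.IsTrail) (a b : V) :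
    |walkFlow p a b| ≤ 1 := by
  classical
  have hnodup : (p.darts.map SimpleGraph.Dart.toProd).Nodup :=
    (List.Nodup.of_map _ hp.edges_nodup).map SimpleGraph.Dart.toProd_injective
  have hab := List.nodup_iff_count_le_one.1 hnodup (a, b)
  have hba := List.nodup_iff_count_le_one.1 hnodup (b, a)
  rw [walkFlow, abs_le]
  constructor <;> omega

open scoped Classical in
theorem walkFlow_cons {u v w : V} (h : H.Adj u v) (p : H.Walk v w) (a b : V) :
    walkFlow (p.cons h) a b = walkFlow p a b +
      ((if a = u ∧ b = v then 1 else 0) - if a = v ∧ b = u then 1 else 0) := by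
  simp only [walkFlow, SimpleGraph.Walk.darts_cons, List.map_cons, List.count_cons, beq_iff_eq,
    Prod.mk.injEq, Nat.cast_add, Nat.cast_ite, Nat.cast_one, Nat.cast_zero, eq_comm (a := u),
    eq_comm (a := v), and_comm (a := b = u)]
  ring

open scoped Classical in
theorem sum_walkFlow [G.LocallyFinite] (hle : H ≤ G) {u v : V} (p : H.Walk u v) (a : V) :
    ∑ b ∈ G.neighborFinset a, walkFlow p a b =
      (if a = u then 1 else 0) - if a = v then 1 else 0 := by
  induction p with
  | nil => simp [walkFlow]
  | @cons u w v h p ih =>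
    have hdart : ∀ c e, G.Adj c e →
        ∑ b ∈ G.neighborFinset a, (if a = c ∧ b = e then (1 : ℤ) else 0) =
          if a = c then 1 else 0 := by
      rintro c e hce
      by_cases hac : a = c
      · subst hac
        simp [hce]
      · simp [hac]
    simp only [walkFlow_cons, Finset.sum_add_distrib, Finset.sum_sub_distrib, ih,
      hdart u w (hle h), hdart w u (hle h).symm]
    ring

theorem exists_isTrail_walkFlow_eq_one {u v : V} (huv : H.Adj u v)
    (hbridge : ¬ H.IsBridge s(u, v)) :
    ∃ q : H.Walk u u, q.IsTrail ∧ walkFlow q u v = 1 := by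
  rw [SimpleGraph.isBridge_iff, not_not] at hbridge
  obtain ⟨p, hp⟩ := hbridge.symm.exists_isPath
  have hle : H.deleteEdges {s(u, v)} ≤ H := SimpleGraph.deleteEdges_le _
  have hnotMem : s(u, v) ∉ (p.mapLe hle).edges := fun h => by
    have := p.edges_subset_edgeSet (by simpa [SimpleGraph.Walk.edges_mapLe_eq_edges] using h)
    simp at this
  refine ⟨(p.mapLe hle).cons huv, ?_, ?_⟩
  · exact (SimpleGraph.Walk.isTrail_cons _ _).2 ⟨hp.isTrail.mapLe hle, hnotMem⟩
  · simp [walkFlow_cons, walkFlow_eq_zero _ hnotMem, huv.ne]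

theorem eq_of_adj_of_reachable_deleteEdges {u v a b : V} (hab : H.Adj a b)
    (ha : (H.deleteEdges {s(u, v)}).Reachable u a)
    (hb : ¬ (H.deleteEdges {s(u, v)}).Reachable u b) : a = u ∧ b = v := by
  have hedge : s(a, b) = s(u, v) := by
    by_contra hne
    exact hb (ha.trans (SimpleGraph.Adj.reachable (by simpa using ⟨hab, by simpa using hne⟩)))
  rcases Sym2.eq_iff.1 hedge with h | h
  · exact h
  · exact absurd (by rw [h.2]) hb

end WalkFlow

/-- A fractional perfect matching of `G` whose weights are multiples of `1 / d`, encoded by `d`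
times its weights: nonnegative integer edge weights with sum `d` at every vertex. -/
structure FractionalMatching {V : Type*} (G : SimpleGraph V) [G.LocallyFinite] (d : ℕ) where
  weight : V → V → ℤ
  symm : ∀ a b, weight a b = weight b a
  adj_of_ne : ∀ a b, weight a b ≠ 0 → G.Adj a b
  nonneg : ∀ a b, 0 ≤ weight a b
  sum_eq : ∀ a, ∑ b ∈ G.neighborFinset a, weight a b = d

namespace FractionalMatching

section Basic

variable {V : Type*} {G : SimpleGraph V} [G.LocallyFinite] {d : ℕ}
  {φ ψ χ : FractionalMatching G d}

theorem sum_weight_eq (φ : FractionalMatching G d) {a : V} {s : Finset V}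
    (hs : ∀ b, φ.weight a b ≠ 0 → b ∈ s) : ∑ b ∈ s, φ.weight a b = d := by
  rw [← φ.sum_eq a]
  refine Finset.sum_congr_of_eq_on_inter (fun b _ hb => ?_) (fun b _ hb => ?_) fun _ _ _ => rfl
  · exact by_contra fun h => hb (by simpa using φ.adj_of_ne a b h)
  · exact by_contra fun h => hb (hs b h)

theorem sum_weight_le (φ : FractionalMatching G d) (a : V) (s : Finset V) :
    ∑ b ∈ s, φ.weight a b ≤ d := by
  classical
  rw [← φ.sum_weight_eq (s := s ∪ G.neighborFinset a) fun b hb => by simp [φ.adj_of_ne a b hb]]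
  exact Finset.sum_le_sum_of_subset_of_nonneg Finset.subset_union_left fun b _ _ => φ.nonneg a b

theorem weight_le (φ : FractionalMatching G d) (a b : V) : φ.weight a b ≤ d := by
  simpa using φ.sum_weight_le a {b}

theorem weight_eq_zero_of_weight_eq (φ : FractionalMatching G d) {a b c : V}
    (hb : φ.weight a b = d) (hne : c ≠ b) : φ.weight a c = 0 := by
  classical
  have hpair := φ.sum_weight_le a {c, b}
  rw [Finset.sum_pair hne] at hpair
  have := φ.nonneg a c
  omega

/-- The graph of properly fractional edges: those whose weight is neither `0` nor `d`. -/
def fracGraph (φ : FractionalMatching G d) : SimpleGraph V where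
  Adj a b := φ.weight a b ≠ 0 ∧ φ.weight a b ≠ d
  symm := ⟨fun a b h => by rwa [φ.symm b a]⟩
  loopless := ⟨fun a h => G.loopless.irrefl a (φ.adj_of_ne a a h.1)⟩

theorem fracGraph_adj {a b : V} :
    φ.fracGraph.Adj a b ↔ φ.weight a b ≠ 0 ∧ φ.weight a b ≠ d := Iff.rfl

theorem fracGraph_le (φ : FractionalMatching G d) : φ.fracGraph ≤ G :=
  fun a b h => φ.adj_of_ne a b h.1

theorem weight_pos_of_fracGraph_adj {a b : V} (h : φ.fracGraph.Adj a b) : 0 < φ.weight a b :=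
  lt_of_le_of_ne (φ.nonneg a b) h.1.symm

theorem weight_lt_of_fracGraph_adj {a b : V} (h : φ.fracGraph.Adj a b) : φ.weight a b < d :=
  lt_of_le_of_ne (φ.weight_le a b) h.2

theorem weight_eq_of_not_fracGraph_adj {a b : V} (h : ¬ φ.fracGraph.Adj a b) :
    φ.weight a b = 0 ∨ φ.weight a b = d := by
  rwa [fracGraph_adj, not_and_or, not_not, not_not] at h

/-- `ψ` refines `φ` if it keeps every weight of `φ` that is already `0` or `d`. -/
def Refines (ψ φ : FractionalMatching G d) : Prop :=
  ∀ a b, ¬ φ.fracGraph.Adj a b → ψ.weight a b = φ.weight a b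

theorem Refines.refl (φ : FractionalMatching G d) : φ.Refines φ := fun _ _ _ => rfl

theorem Refines.fracGraph_le (h : ψ.Refines φ) : ψ.fracGraph ≤ φ.fracGraph := fun a b hab => by
  by_contra hnot
  exact hnot (by rwa [fracGraph_adj, ← h a b hnot])

theorem Refines.trans (h : χ.Refines ψ) (h' : ψ.Refines φ) : χ.Refines φ := fun a b hab => by
  rw [h a b fun hψ => hab (h'.fracGraph_le hψ), h' a b hab]

/-- All edges at `x` have weight `0` or `d`. -/
def IntegralAt (φ : FractionalMatching G d) (x : V) : Prop := ∀ y, ¬ φ.fracGraph.Adj x y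

theorem IntegralAt.of_refines {x : V} (hx : φ.IntegralAt x) (h : ψ.Refines φ) :
    ψ.IntegralAt x := fun y hy => hx y (h.fracGraph_le hy)

theorem integralAt_of_weight_eq {x y : V} (h : φ.weight x y = d) : φ.IntegralAt x := by
  intro z hz
  by_cases hzy : z = y
  · exact hz.2 (hzy ▸ h)
  · exact hz.1 (φ.weight_eq_zero_of_weight_eq h hzy)

theorem IntegralAt.existsUnique_weight_eq {x : V} (hx : φ.IntegralAt x) (hd : d ≠ 0) :
    ∃! y, φ.weight x y = d := by
  obtain ⟨y, -, hy⟩ : ∃ y ∈ G.neighborFinset x, φ.weight x y ≠ 0 :=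
    Finset.exists_ne_zero_of_sum_ne_zero (by rw [φ.sum_eq x]; exact_mod_cast hd)
  have hyd : φ.weight x y = d := (weight_eq_of_not_fracGraph_adj (hx y)).resolve_left hy
  refine ⟨y, hyd, fun z (hz : φ.weight x z = d) => by_contra fun hzy => hd ?_⟩
  exact_mod_cast hz.symm.trans (φ.weight_eq_zero_of_weight_eq hyd hzy)

/-- `ψ` arises from `φ` by changing finitely many fractional weights, all of them in the connected
component of `x`. -/
structure LocallyRefines (ψ φ : FractionalMatching G d) (x : V) : Prop where
  refines : ψ.Refines φ
  finite_ne : {p : V × V | ψ.weight p.1 p.2 ≠ φ.weight p.1 p.2}.Finite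
  reachable_of_ne : ∀ a b, ψ.weight a b ≠ φ.weight a b → G.Reachable x a

theorem LocallyRefines.refl (φ : FractionalMatching G d) (x : V) : φ.LocallyRefines φ x :=
  ⟨.refl φ, by simp, by simp⟩

theorem LocallyRefines.trans {x : V} (h : χ.LocallyRefines ψ x) (h' : ψ.LocallyRefines φ x) :
    χ.LocallyRefines φ x := by
  have hor : ∀ a b, χ.weight a b ≠ φ.weight a b →
      χ.weight a b ≠ ψ.weight a b ∨ ψ.weight a b ≠ φ.weight a b := fun a b hab => by
    by_contra! heq
    exact hab (heq.1.trans heq.2)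
  exact ⟨h.refines.trans h'.refines, (h.finite_ne.union h'.finite_ne).subset fun p => hor p.1 p.2,
    fun a b hab => (hor a b hab).elim (h.reachable_of_ne a b) (h'.reachable_of_ne a b)⟩

theorem LocallyRefines.almostOneEnded {x : V} (h : ψ.LocallyRefines φ x)
    (hend : AlmostOneEnded G φ.fracGraph) : AlmostOneEnded G ψ.fracGraph :=
  hend.mono_of_finite_diff h.refines.fracGraph_le <| h.finite_ne.subset fun p hp heq =>
    hp.2 (by rw [fracGraph_adj, heq]; exact hp.1)

end Basic

section Rounding

variable {V : Type*} {G : SimpleGraph V} [G.LocallyFinite] {d : ℕ}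

open scoped Classical in
theorem sum_sign_mul_weight_boundary (φ : FractionalMatching G d) {sgn : V → ℤˣ}
    (hsgn : ∀ a b, G.Adj a b → sgn b = -sgn a) (S : Finset V) :
    ∑ a ∈ S, ∑ b ∈ G.neighborFinset a with b ∉ S, (sgn a : ℤ) * φ.weight a b =
      d * ∑ a ∈ S, (sgn a : ℤ) := by
  have hanti : ∀ a b, (sgn a : ℤ) * φ.weight a b = -(sgn b * φ.weight b a) := fun a b => by
    by_cases hab : φ.weight a b = 0
    · simp [hab, φ.symm b a]
    · simp [hsgn a b (φ.adj_of_ne a b hab), φ.symm b a]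
  have hinner : ∑ a ∈ S, ∑ b ∈ S, (sgn a : ℤ) * φ.weight a b = 0 := by
    refine self_eq_neg.1 ?_
    conv_lhs => rw [Finset.sum_comm]
    simp only [← Finset.sum_neg_distrib, ← hanti]
  have hsplit : ∀ a, ∑ b ∈ S, (sgn a : ℤ) * φ.weight a b +
      ∑ b ∈ G.neighborFinset a with b ∉ S, (sgn a : ℤ) * φ.weight a b = d * sgn a := fun a => by
    rw [← Finset.sum_union (by simp +contextual [Finset.disjoint_left]),
      ← Finset.mul_sum, φ.sum_weight_eq, mul_comm]
    intro b hb
    by_cases hbS : b ∈ S <;> simp [hbS, φ.adj_of_ne a b hb]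
  rw [Finset.mul_sum, ← Finset.sum_congr rfl fun a _ => hsplit a, Finset.sum_add_distrib, hinner,
    zero_add]

theorem infinite_of_unique_fracGraph_boundary (φ : FractionalMatching G d) (hbip : G.IsBipartite)
    {S : Set V} {u v : V} (huv : φ.fracGraph.Adj u v) (hu : u ∈ S) (hv : v ∉ S)
    (huniq : ∀ a ∈ S, ∀ b ∉ S, φ.fracGraph.Adj a b → a = u ∧ b = v) : S.Infinite := by
  classical
  intro hS
  lift S to Finset V using hS
  obtain ⟨sgn, hsgn_u, hsgn⟩ := exists_sign_of_isBipartite hbip u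
  have hzero : ∀ a ∈ S, ∀ b ∉ S, ¬ (a = u ∧ b = v) → (φ.weight a b : ZMod d) = 0 := by
    intro a ha b hb hne
    rcases weight_eq_of_not_fracGraph_adj fun h => hne (huniq a ha b hb h) with h | h <;> simp [h]
  -- Modulo `d`, the edge `uv` alone contributes to the boundary sum, and it contributes `0`.
  have hsum := congrArg (Int.cast : ℤ → ZMod d) (φ.sum_sign_mul_weight_boundary hsgn S)
  push_cast at hsum
  rw [Finset.sum_eq_single_of_mem u (by simpa using hu), Finset.sum_eq_single_of_mem v, hsgn_u]
    at hsum
  · simp only [CharP.cast_eq_zero, zero_mul, Units.val_one, Int.cast_one, one_mul,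
      ZMod.intCast_zmod_eq_zero_iff_dvd] at hsum
    exact (weight_lt_of_fracGraph_adj huv).not_ge
      (Int.le_of_dvd (weight_pos_of_fracGraph_adj huv) hsum)
  · simpa using ⟨φ.fracGraph_le huv, hv⟩
  · intro b hb hbv
    rw [hzero u hu b (Finset.mem_filter.1 hb).2 fun h => hbv h.2, mul_zero]
  · intro a ha hau
    refine Finset.sum_eq_zero fun b hb => ?_
    rw [hzero a ha b (Finset.mem_filter.1 hb).2 fun h => hau h.1, mul_zero]

theorem infinite_reachable_deleteEdges (φ : FractionalMatching G d) (hbip : G.IsBipartite)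
    {u v : V} (huv : φ.fracGraph.Adj u v) (hbridge : φ.fracGraph.IsBridge s(u, v)) :
    {w | (φ.fracGraph.deleteEdges {s(u, v)}).Reachable u w}.Infinite :=
  φ.infinite_of_unique_fracGraph_boundary hbip huv (.refl u) (SimpleGraph.isBridge_iff.1 hbridge)
    fun _ ha _ hb hab => eq_of_adj_of_reachable_deleteEdges hab ha hb

theorem not_isBridge (φ : FractionalMatching G d) (hbip : G.IsBipartite)
    (hend : AlmostOneEnded G φ.fracGraph) {u v : V} (huv : φ.fracGraph.Adj u v) :
    ¬ φ.fracGraph.IsBridge s(u, v) := by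
  intro hbridge
  set K := φ.fracGraph.deleteEdges {s(u, v)} with hK
  have hKle : K ≤ φ.fracGraph := SimpleGraph.deleteEdges_le _
  have hu : {w | K.Reachable u w}.Infinite := φ.infinite_reachable_deleteEdges hbip huv hbridge
  have hv : {w | K.Reachable v w}.Infinite := by
    rw [Sym2.eq_swap] at hbridge
    simpa only [hK, Sym2.eq_swap] using φ.infinite_reachable_deleteEdges hbip huv.symm hbridge
  have hside : ∀ {t w}, φ.fracGraph.Reachable u t → {z | K.Reachable t z}.Infinite →
      K.Reachable t w → G.Reachable u w ∧ {z | φ.fracGraph.Reachable w z}.Infinite :=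
    fun hut ht htw => ⟨(hut.trans (htw.mono hKle)).mono φ.fracGraph_le,
      ht.mono fun z hz => (htw.symm.trans hz).mono hKle⟩
  have hboundary : {p : V × V | G.Reachable u p.1 ∧ φ.fracGraph.Adj p.1 p.2 ∧
      p.1 ∈ {w | K.Reachable u w} ∧ p.2 ∉ {w | K.Reachable u w}} ⊆ {(u, v)} := fun p hp =>
    Prod.ext_iff.2 (eq_of_adj_of_reachable_deleteEdges hp.2.1 hp.2.2.1 hp.2.2.2)
  rcases hend u _ ((Set.finite_singleton _).subset hboundary) with hfin | hfin
  · exact hu (hfin.subset fun w hw =>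
      have h := hside (.refl u) hu hw
      ⟨h.1, h.2, hw⟩)
  · exact hv (hfin.subset fun w hw =>
      have h := hside huv.reachable hv hw
      ⟨h.1, h.2, fun huw => hbridge (huw.trans hw.symm)⟩)

theorem exists_weight_eq_add_walkFlow (φ : FractionalMatching G d) {sgn : V → ℤˣ}
    (hsgn : ∀ a b, G.Adj a b → sgn b = -sgn a) {u : V} {q : φ.fracGraph.Walk u u}
    (hq : q.IsTrail) :
    ∃ ψ : FractionalMatching G d,
      ∀ a b, ψ.weight a b = φ.weight a b + sgn a * walkFlow q a b := by
  have flow_of_not_adj : ∀ {a b}, ¬ φ.fracGraph.Adj a b → walkFlow q a b = 0 := fun h =>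
    walkFlow_eq_zero q fun hedge => h (q.edges_subset_edgeSet hedge)
  refine ⟨⟨fun a b => φ.weight a b + sgn a * walkFlow q a b, fun a b => ?_, fun a b h => ?_,
    fun a b => ?_, fun a => ?_⟩, fun _ _ => rfl⟩
  · by_cases hab : φ.fracGraph.Adj a b
    · simp [φ.symm a b, hsgn a b (φ.fracGraph_le hab), walkFlow_swap q a b]
    · simp [φ.symm a b, flow_of_not_adj hab, flow_of_not_adj fun h => hab h.symm]
  · by_cases hab : φ.fracGraph.Adj a b
    · exact φ.fracGraph_le hab
    · exact φ.adj_of_ne a b (by simpa [flow_of_not_adj hab] using h)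
  · by_cases hab : φ.fracGraph.Adj a b
    · have hpos := weight_pos_of_fracGraph_adj hab
      have hflow := abs_le.1 (abs_walkFlow_le_one hq a b)
      rcases Int.units_eq_one_or (sgn a) with h | h <;> simp only [h, Units.val_neg,
        Units.val_one] <;> omega
    · simpa [flow_of_not_adj hab] using φ.nonneg a b
  · rw [Finset.sum_add_distrib, φ.sum_eq, ← Finset.mul_sum, sum_walkFlow φ.fracGraph_le, sub_self,
      mul_zero, add_zero]

theorem exists_locallyRefines_weight_eq_add_one (φ : FractionalMatching G d)
    (hbip : G.IsBipartite) (hend : AlmostOneEnded G φ.fracGraph) {u v : V}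
    (huv : φ.fracGraph.Adj u v) :
    ∃ ψ : FractionalMatching G d, ψ.LocallyRefines φ u ∧ ψ.weight u v = φ.weight u v + 1 := by
  obtain ⟨sgn, hsgn_u, hsgn⟩ := exists_sign_of_isBipartite hbip u
  obtain ⟨q, hq, hquv⟩ := exists_isTrail_walkFlow_eq_one huv (φ.not_isBridge hbip hend huv)
  obtain ⟨ψ, hψ⟩ := φ.exists_weight_eq_add_walkFlow hsgn hq
  have mem_edges : ∀ {a b}, ψ.weight a b ≠ φ.weight a b → s(a, b) ∈ q.edges := fun {a b} hab => by
    by_contra hmem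
    exact hab (by rw [hψ, walkFlow_eq_zero q hmem, mul_zero, add_zero])
  refine ⟨ψ, ⟨fun a b hab => ?_, ?_, fun a b hab => ?_⟩, by simp [hψ, hsgn_u, hquv]⟩
  · by_contra hne
    exact hab (q.edges_subset_edgeSet (mem_edges hne))
  · refine ((List.finite_toSet q.support).prod (List.finite_toSet q.support)).subset fun p hp => ?_
    exact ⟨q.fst_mem_support_of_mem_edges (mem_edges hp),
      q.snd_mem_support_of_mem_edges (mem_edges hp)⟩
  · classical
    exact (q.takeUntil a (q.fst_mem_support_of_mem_edges (mem_edges hab))).reachable.mono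
      φ.fracGraph_le

theorem exists_locallyRefines_weight_eq (φ : FractionalMatching G d) (hbip : G.IsBipartite)
    (hend : AlmostOneEnded G φ.fracGraph) {u v : V} (huv : φ.weight u v ≠ 0) :
    ∃ ψ : FractionalMatching G d, ψ.LocallyRefines φ u ∧ ψ.weight u v = d := by
  induction h : (d - φ.weight u v).toNat generalizing φ with
  | zero => exact ⟨φ, .refl φ u, by have := φ.weight_le u v; omega⟩
  | succ n ih =>
    obtain ⟨ψ, hψ, hψuv⟩ := φ.exists_locallyRefines_weight_eq_add_one hbip hend ⟨huv, by omega⟩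
    have := φ.nonneg u v
    obtain ⟨χ, hχ, hχuv⟩ := ih ψ (hψ.almostOneEnded hend) (by omega) (by omega)
    exact ⟨χ, hχ.trans hψ, hχuv⟩

theorem exists_locallyRefines_integralAt (φ : FractionalMatching G d) (hbip : G.IsBipartite)
    (hend : AlmostOneEnded G φ.fracGraph) (x : V) :
    ∃ ψ : FractionalMatching G d, ψ.LocallyRefines φ x ∧ ψ.IntegralAt x := by
  by_cases hx : φ.IntegralAt x
  · exact ⟨φ, .refl φ x, hx⟩
  · simp only [IntegralAt, not_forall, not_not] at hx
    obtain ⟨y, hy⟩ := hx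
    obtain ⟨ψ, hψ, hψxy⟩ := φ.exists_locallyRefines_weight_eq hbip hend hy.1
    exact ⟨ψ, hψ, integralAt_of_weight_eq hψxy⟩

end Rounding

section Patch

variable {V κ Y : Type*} {G : SimpleGraph V} [G.LocallyFinite] {d : ℕ}

/-- The vertex `w p` of the window `w` has a fractional edge leaving the window. -/
def IsOuter (φ : FractionalMatching G d) (w : κ → V) (p : κ) : Prop :=
  ∃ t ∉ range w, φ.fracGraph.Adj (w p) t

/-- The weights of `φ` inside the window `w` may be replaced by the matrix `M`: this gives again a
fractional perfect matching that refines `φ`, and fractional paths of the new matching inside the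
window connect all vertices at which fractional edges leave the window. -/
structure IsReplacement [Fintype κ] (φ : FractionalMatching G d) (w : κ → V) (M : κ → κ → ℤ) :
    Prop where
  symm : ∀ p q, M p q = M q p
  nonneg : ∀ p q, 0 ≤ M p q
  eq_of_not_adj : ∀ p q, ¬ φ.fracGraph.Adj (w p) (w q) → M p q = φ.weight (w p) (w q)
  sum_eq : ∀ p, ∑ q, M p q = ∑ q, φ.weight (w p) (w q)
  reflTransGen_of_isOuter : ∀ p q, φ.IsOuter w p → φ.IsOuter w q →
    Relation.ReflTransGen (fun i j => M i j ≠ 0 ∧ M i j ≠ d) p q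

theorem sum_weight_sub_eq_zero (ψ φ : FractionalMatching G d) {a : V} {s : Finset V}
    (hs : ∀ b, ψ.weight a b ≠ φ.weight a b → b ∈ s) :
    ∑ b ∈ s, (ψ.weight a b - φ.weight a b) = 0 := by
  rw [Finset.sum_congr_of_eq_on_inter (s₂ := G.neighborFinset a) (g := fun b =>
    ψ.weight a b - φ.weight a b) (fun b _ hb => ?_) (fun b _ hb => ?_) fun _ _ _ => rfl,
    Finset.sum_sub_distrib, ψ.sum_eq, φ.sum_eq, sub_self]
  · rw [SimpleGraph.mem_neighborFinset] at hb
    rw [not_imp_comm.1 (ψ.adj_of_ne a b) hb, not_imp_comm.1 (φ.adj_of_ne a b) hb, sub_self]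
  · exact sub_eq_zero.2 (not_imp_comm.1 (hs b) hb)

theorem Refines.isReplacement [Fintype κ] {φ ψ : FractionalMatching G d} (h : ψ.Refines φ)
    {w : κ → V} (hw : w.Injective) (hsupp : ∀ a b, ψ.weight a b ≠ φ.weight a b → a ∈ range w)
    (hconn : ∀ a b : range w, (∃ t ∉ range w, ψ.fracGraph.Adj a t) →
      (∃ t ∉ range w, ψ.fracGraph.Adj b t) → (ψ.fracGraph.induce (range w)).Reachable a b) :
    φ.IsReplacement w fun p q => ψ.weight (w p) (w q) := by
  classical
  have mem_range_of_ne : ∀ a b, ψ.weight a b ≠ φ.weight a b → b ∈ range w := fun a b hab =>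
    hsupp b a (by rwa [ψ.symm, φ.symm])
  have exit_of_isOuter : ∀ {p}, φ.IsOuter w p → ∃ t ∉ range w, ψ.fracGraph.Adj (w p) t := by
    rintro p ⟨t, ht, hpt⟩
    refine ⟨t, ht, ?_⟩
    rwa [fracGraph_adj, not_imp_comm.1 (mem_range_of_ne (w p) t) ht]
  refine ⟨fun p q => ψ.symm _ _, fun p q => ψ.nonneg _ _, fun p q => h _ _, fun p => ?_,
    fun p q hp hq => ?_⟩
  · rw [← sub_eq_zero, ← Finset.sum_sub_distrib,
      ← sum_weight_sub_eq_zero ψ φ (s := Finset.univ.image w) fun b hb => by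
        simpa using mem_range_of_ne _ b hb, Finset.sum_image hw.injOn]
  · have hreach := hconn ⟨w p, p, rfl⟩ ⟨w q, q, rfl⟩ (exit_of_isOuter hp) (exit_of_isOuter hq)
    rw [SimpleGraph.reachable_iff_reflTransGen] at hreach
    have apply_symm : ∀ a : range w, w ((Equiv.ofInjective w hw).symm a) = a :=
      Equiv.apply_ofInjective_symm hw
    simpa [Function.onFun] using Relation.ReflTransGen.lift
      (p := fun i j => ψ.weight (w i) (w j) ≠ 0 ∧ ψ.weight (w i) (w j) ≠ d)
      (Equiv.ofInjective w hw).symm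
      (fun a b hab => by simp only [Function.onFun, apply_symm]; exact hab) _ _ hreach

theorem exists_isReplacement (φ : FractionalMatching G d) (hbip : G.IsBipartite)
    (hend : AlmostOneEnded G φ.fracGraph) (x : V) :
    ∃ (n : ℕ) (w : Fin n → V) (M : Fin n → Fin n → ℤ) (c : Fin n), w.Injective ∧
      φ.IsReplacement w M ∧ w c = x ∧ (∀ p, G.Reachable x (w p)) ∧ ¬ φ.IsOuter w c ∧
      ∀ q, M c q = 0 ∨ M c q = d := by
  obtain ⟨ψ, hψ, hx⟩ := φ.exists_locallyRefines_integralAt hbip hend x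
  let W₀ : Set V := insert x (G.neighborSet x) ∪
    Prod.fst '' {p : V × V | ψ.weight p.1 p.2 ≠ φ.weight p.1 p.2}
  obtain ⟨W, hWfin, hW₀W, hWx, hW⟩ := (hψ.almostOneEnded hend).exists_finite_superset
    ψ.fracGraph_le (W₀ := W₀) (((Set.toFinite _).insert x).union (hψ.finite_ne.image _)) <| by
      rintro z ((rfl | hz) | ⟨p, hp, rfl⟩)
      · exact .refl z
      · exact SimpleGraph.Adj.reachable hz
      · exact hψ.reachable_of_ne _ _ hp
  obtain ⟨n, w, rfl⟩ := hWfin.fin_embedding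
  obtain ⟨c, rfl⟩ := hW₀W (Or.inl (mem_insert x _))
  refine ⟨n, w, fun p q => ψ.weight (w p) (w q), c, w.injective,
    hψ.refines.isReplacement w.injective (fun a b hab => hW₀W (Or.inr ⟨(a, b), hab, rfl⟩)) hW, rfl,
    fun p => hWx _ ⟨p, rfl⟩, ?_, fun q => weight_eq_of_not_fracGraph_adj (hx _)⟩
  rintro ⟨t, ht, hct⟩
  exact ht (hW₀W (Or.inl (Or.inr (φ.fracGraph_le hct))))

variable {φ : FractionalMatching G d} {w : Y → κ → V} {M : κ → κ → ℤ}

/-- The weights of `φ`, replaced by the matrix `M` inside each of the windows `w y`. -/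
noncomputable def patchWeight (φ : FractionalMatching G d) (w : Y → κ → V) (M : κ → κ → ℤ)
    (u v : V) : ℤ :=
  Function.extend (fun k : Y × κ × κ => (w k.1 k.2.1, w k.1 k.2.2)) (fun k => M k.2.1 k.2.2)
    (fun e => φ.weight e.1 e.2) (u, v)

theorem injective_window_pair (hw : Function.Injective fun k : Y × κ => w k.1 k.2) :
    Function.Injective fun k : Y × κ × κ => (w k.1 k.2.1, w k.1 k.2.2) := by
  rintro ⟨y, p, q⟩ ⟨y', p', q'⟩ h
  have hp : (y, p) = (y', p') := hw (congrArg Prod.fst h)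
  have hq : (y, q) = (y', q') := hw (congrArg Prod.snd h)
  rw [Prod.mk.injEq] at hp hq
  rw [hp.1, hp.2, hq.2]

theorem patchWeight_window (hw : Function.Injective fun k : Y × κ => w k.1 k.2) (y : Y) (p q : κ) :
    patchWeight φ w M (w y p) (w y q) = M p q :=
  (injective_window_pair hw).extend_apply _ _ (y, p, q)

theorem patchWeight_of_notMem_range {u v : V} (h : ∀ y, u ∈ range (w y) → v ∉ range (w y)) :
    patchWeight φ w M u v = φ.weight u v := by
  refine Function.extend_apply' _ _ _ ?_
  rintro ⟨k, hk⟩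
  exact h k.1 ⟨_, congrArg Prod.fst hk⟩ ⟨_, congrArg Prod.snd hk⟩

theorem patchWeight_induction (hw : Function.Injective fun k : Y × κ => w k.1 k.2)
    {motive : V → V → ℤ → Prop} (window : ∀ y p q, motive (w y p) (w y q) (M p q))
    (off : ∀ u v, (∀ y, u ∈ range (w y) → v ∉ range (w y)) → motive u v (φ.weight u v))
    (u v : V) : motive u v (patchWeight φ w M u v) := by
  by_cases h : ∀ y, u ∈ range (w y) → v ∉ range (w y)
  · rw [patchWeight_of_notMem_range h]
    exact off u v h
  · push Not at h
    obtain ⟨y, ⟨p, rfl⟩, q, rfl⟩ := h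
    rw [patchWeight_window hw]
    exact window y p q

variable [Fintype κ]

theorem patchWeight_of_not_adj (hw : Function.Injective fun k : Y × κ => w k.1 k.2)
    (hM : ∀ y, φ.IsReplacement (w y) M) (u v : V) :
    ¬ φ.fracGraph.Adj u v → patchWeight φ w M u v = φ.weight u v :=
  patchWeight_induction hw (motive := fun u v m => ¬ φ.fracGraph.Adj u v → m = φ.weight u v)
    (fun y p q => (hM y).eq_of_not_adj p q) (fun _ _ _ _ => rfl) u v

theorem sum_patchWeight (hw : Function.Injective fun k : Y × κ => w k.1 k.2)
    (hM : ∀ y, φ.IsReplacement (w y) M) (u : V) :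
    ∑ v ∈ G.neighborFinset u, patchWeight φ w M u v = d := by
  classical
  rw [← φ.sum_eq u]
  by_cases hu : ∃ y, u ∈ range (w y)
  · obtain ⟨y, p, rfl⟩ := hu
    have eq_of_notMem : ∀ v ∉ Finset.univ.image (w y),
        patchWeight φ w M (w y p) v - φ.weight (w y p) v = 0 := by
      intro v hv
      rw [sub_eq_zero]
      refine patchWeight_of_notMem_range ?_
      rintro y' ⟨p', hp'⟩ ⟨q, rfl⟩
      obtain rfl : y' = y := congrArg Prod.fst (hw (a₁ := (y', p')) (a₂ := (y, p)) hp')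
      exact hv (Finset.mem_image_of_mem _ (Finset.mem_univ q))
    have eq_of_not_adj : ∀ v ∉ G.neighborFinset (w y p),
        patchWeight φ w M (w y p) v - φ.weight (w y p) v = 0 := fun v hv =>
      sub_eq_zero.2 (patchWeight_of_not_adj hw hM _ _ fun h =>
        hv ((SimpleGraph.mem_neighborFinset ..).2 (φ.fracGraph_le h)))
    have window_injective : (w y).Injective := fun p q hpq =>
      congrArg Prod.snd (hw (a₁ := (y, p)) (a₂ := (y, q)) hpq)
    rw [← sub_eq_zero, ← Finset.sum_sub_distrib, Finset.sum_congr_of_eq_on_inter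
      (s₂ := Finset.univ.image (w y)) (fun v _ hv => eq_of_notMem v hv)
      (fun v _ hv => eq_of_not_adj v hv) fun _ _ _ => rfl,
      Finset.sum_image window_injective.injOn, Finset.sum_sub_distrib, ← (hM y).sum_eq p,
      sub_eq_zero]
    exact Finset.sum_congr rfl fun q _ => patchWeight_window hw y p q
  · exact Finset.sum_congr rfl fun v _ => patchWeight_of_notMem_range fun y hy => (hu ⟨y, hy⟩).elim

/-- The fractional matching obtained from `φ` by replacing its weights inside each of the disjoint
windows `w y` by the matrix `M`. -/
noncomputable def patch (hw : Function.Injective fun k : Y × κ => w k.1 k.2)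
    (hM : ∀ y, φ.IsReplacement (w y) M) : FractionalMatching G d where
  weight := patchWeight φ w M
  symm u v := by
    refine patchWeight_induction hw (motive := fun u v m => m = patchWeight φ w M v u)
      (fun y p q => ?_) (fun u v h => ?_) u v
    · rw [patchWeight_window hw, (hM y).symm]
    · rw [patchWeight_of_notMem_range fun y hv hu => h y hu hv, φ.symm]
  adj_of_ne u v h := by
    by_contra hadj
    rw [patchWeight_of_not_adj hw hM u v fun h => hadj (φ.fracGraph_le h)] at h
    exact hadj (φ.adj_of_ne u v h)
  nonneg := patchWeight_induction hw (motive := fun _ _ m => 0 ≤ m) (fun y => (hM y).nonneg)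
    fun u v _ => φ.nonneg u v
  sum_eq := sum_patchWeight hw hM

section

variable (hw : Function.Injective fun k : Y × κ => w k.1 k.2) (hM : ∀ y, φ.IsReplacement (w y) M)

theorem patch_weight (u v : V) : (patch hw hM).weight u v = patchWeight φ w M u v := rfl

theorem patch_refines : (patch hw hM).Refines φ := patchWeight_of_not_adj hw hM

theorem patch_fracGraph_adj_window (y : Y) (p q : κ) :
    (patch hw hM).fracGraph.Adj (w y p) (w y q) ↔ M p q ≠ 0 ∧ M p q ≠ d := by
  rw [fracGraph_adj, patch_weight, patchWeight_window hw]

theorem patch_fracGraph_adj_of_notMem_range {u v : V}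
    (h : ∀ y, u ∈ range (w y) → v ∉ range (w y)) :
    (patch hw hM).fracGraph.Adj u v ↔ φ.fracGraph.Adj u v := by
  rw [fracGraph_adj, fracGraph_adj, patch_weight, patchWeight_of_notMem_range h]

theorem patch_integralAt {y : Y} {p : κ} (hp : ¬ φ.IsOuter (w y) p)
    (hMp : ∀ q, M p q = 0 ∨ M p q = d) : (patch hw hM).IntegralAt (w y p) := by
  intro v hv
  by_cases hvw : v ∈ range (w y)
  · obtain ⟨q, rfl⟩ := hvw
    have hpq := (patch_fracGraph_adj_window hw hM y p q).1 hv
    exact (hMp q).elim hpq.1 hpq.2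
  · exact hp ⟨v, hvw, (patch_refines hw hM).fracGraph_le hv⟩

end

end Patch

section Recolor

variable {V κ Y : Type*} {G : SimpleGraph V} [G.LocallyFinite] {d : ℕ}
  {φ : FractionalMatching G d} {M : κ → κ → ℤ} {S : Set V}

/-- No edge of fractional weight inside the window `w`, carrying the weights `M`, leaves `S`. -/
def IsPure (d : ℕ) (M : κ → κ → ℤ) (w : κ → V) (S : Set V) : Prop :=
  ∀ p q, M p q ≠ 0 → M p q ≠ d → w p ∈ S → w q ∈ S

theorem IsReplacement.mem_iff_of_isOuter [Fintype κ] {w : κ → V} (hM : φ.IsReplacement w M)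
    (hpure : IsPure d M w S) {p q : κ} (hp : φ.IsOuter w p) (hq : φ.IsOuter w q) :
    w p ∈ S ↔ w q ∈ S := by
  have mem_of_path : ∀ {p q}, Relation.ReflTransGen (fun i j => M i j ≠ 0 ∧ M i j ≠ d) p q →
      w p ∈ S → w q ∈ S := by
    intro p q hpq hpS
    induction hpq with
    | refl => exact hpS
    | tail _ hij ih => exact hpure _ _ hij.1 hij.2 ih
  exact ⟨mem_of_path (hM.reflTransGen_of_isOuter p q hp hq),
    mem_of_path (hM.reflTransGen_of_isOuter q p hq hp)⟩

/-- The set `S`, changed on the pure windows so as to be constant there: a pure window is contained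
in the new set if `S` contains an outer vertex of it. This turns a set with finite boundary among
the fractional edges of a patched matching into one with finite boundary among those of `φ`. -/
def recolor (φ : FractionalMatching G d) (w : Y → κ → V) (M : κ → κ → ℤ) (S : Set V) : Set V :=
  {v | (∃ y, v ∈ range (w y) ∧ IsPure d M (w y) S ∧ ∃ q, φ.IsOuter (w y) q ∧ w y q ∈ S) ∨
    (∀ y, v ∈ range (w y) → ¬ IsPure d M (w y) S) ∧ v ∈ S}

variable {w : Y → κ → V}

theorem mem_recolor_of_isPure (hw : Function.Injective fun k : Y × κ => w k.1 k.2) {y : Y}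
    (hpure : IsPure d M (w y) S) (p : κ) :
    w y p ∈ recolor φ w M S ↔ ∃ q, φ.IsOuter (w y) q ∧ w y q ∈ S := by
  refine ⟨?_, fun h => Or.inl ⟨y, ⟨p, rfl⟩, hpure, h⟩⟩
  rintro (⟨y', ⟨p', hp'⟩, -, h⟩ | ⟨h, -⟩)
  · obtain rfl : y' = y := congrArg Prod.fst (hw (a₁ := (y', p')) (a₂ := (y, p)) hp')
    exact h
  · exact absurd hpure (h y ⟨p, rfl⟩)

theorem mem_recolor_of_not_isPure {v : V} (hv : ∀ y, v ∈ range (w y) → ¬ IsPure d M (w y) S) :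
    v ∈ recolor φ w M S ↔ v ∈ S := by
  refine ⟨?_, fun h => Or.inr ⟨hv, h⟩⟩
  rintro (⟨y, hy, hpure, -⟩ | ⟨-, h⟩)
  · exact absurd hpure (hv y hy)
  · exact h

variable [Fintype κ]

theorem mem_recolor_iff_of_isOuter (hw : Function.Injective fun k : Y × κ => w k.1 k.2)
    (hM : ∀ y, φ.IsReplacement (w y) M) {y : Y} (hpure : IsPure d M (w y) S) (p : κ) {q : κ}
    (hq : φ.IsOuter (w y) q) : w y p ∈ recolor φ w M S ↔ w y q ∈ S := by
  rw [mem_recolor_of_isPure hw hpure]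
  refine ⟨?_, fun h => ⟨q, hq, h⟩⟩
  rintro ⟨q', hq', h⟩
  exact ((hM y).mem_iff_of_isOuter hpure hq' hq).1 h

theorem mem_recolor_iff_of_adj (hw : Function.Injective fun k : Y × κ => w k.1 k.2)
    (hM : ∀ y, φ.IsReplacement (w y) M) {u v : V} (huv : φ.fracGraph.Adj u v)
    (h : ∀ y, u ∈ range (w y) → v ∉ range (w y)) : u ∈ recolor φ w M S ↔ u ∈ S := by
  by_cases hu : ∃ y, u ∈ range (w y) ∧ IsPure d M (w y) S
  · obtain ⟨y, ⟨p, rfl⟩, hpure⟩ := hu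
    exact mem_recolor_iff_of_isOuter hw hM hpure p ⟨v, h y ⟨p, rfl⟩, huv⟩
  · exact mem_recolor_of_not_isPure fun y hy hpure => hu ⟨y, hy, hpure⟩

theorem mem_recolor_iff_of_infinite (hw : Function.Injective fun k : Y × κ => w k.1 k.2)
    (hM : ∀ y, φ.IsReplacement (w y) M) {v : V}
    (hv : {t | (patch hw hM).fracGraph.Reachable v t}.Infinite) :
    v ∈ recolor φ w M S ↔ v ∈ S := by
  by_cases hpure : ∃ y, v ∈ range (w y) ∧ IsPure d M (w y) S
  · obtain ⟨y, ⟨p, rfl⟩, hpure⟩ := hpure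
    obtain ⟨t, ⟨walk⟩, htw⟩ := (hv.sdiff (finite_range (w y))).nonempty
    have mem_iff_of_adj : ∀ q q', (patch hw hM).fracGraph.Adj (w y q) (w y q') →
        (w y q ∈ S ↔ w y q' ∈ S) := by
      intro q q' h
      have hM' := (patch_fracGraph_adj_window hw hM y q q').1 h
      have hM'' := (patch_fracGraph_adj_window hw hM y q' q).1 h.symm
      exact ⟨hpure q q' hM'.1 hM'.2, hpure q' q hM''.1 hM''.2⟩
    obtain ⟨⟨⟨-, s⟩, hqs⟩, -, ⟨⟨q, rfl⟩, hq⟩, hs⟩ :=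
      walk.exists_boundary_dart {u | u ∈ range (w y) ∧ (w y p ∈ S ↔ u ∈ S)} ⟨⟨p, rfl⟩, Iff.rfl⟩
        fun h => htw h.1
    have hsw : s ∉ range (w y) := by
      rintro ⟨q', rfl⟩
      exact hs ⟨⟨q', rfl⟩, hq.trans (mem_iff_of_adj q q' hqs)⟩
    rw [mem_recolor_iff_of_isOuter hw hM hpure p ⟨s, hsw, (patch_refines hw hM).fracGraph_le hqs⟩,
      hq]
  · exact mem_recolor_of_not_isPure fun y hy hy' => hpure ⟨y, hy, hy'⟩

theorem finite_setOf_not_isPure (hw : Function.Injective fun k : Y × κ => w k.1 k.2)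
    (hM : ∀ y, φ.IsReplacement (w y) M) {x : V}
    (hS : {e : V × V | G.Reachable x e.1 ∧ (patch hw hM).fracGraph.Adj e.1 e.2 ∧ e.1 ∈ S ∧
      e.2 ∉ S}.Finite) :
    {y | (∀ p, G.Reachable x (w y p)) ∧ ¬ IsPure d M (w y) S}.Finite := by
  have window_injective : ∀ p q, Function.Injective fun y => (w y p, w y q) := fun p q y y' h =>
    congrArg Prod.fst (hw (a₁ := (y, p)) (a₂ := (y', p)) (congrArg Prod.fst h))
  refine (finite_iUnion fun p => finite_iUnion fun q =>
    hS.preimage (window_injective p q).injOn).subset ?_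
  rintro y ⟨hy, hpure⟩
  simp only [IsPure, not_forall] at hpure
  obtain ⟨p, q, h0, hd, hp, hq⟩ := hpure
  exact mem_iUnion₂.2 ⟨p, q, hy p, (patch_fracGraph_adj_window hw hM y p q).2 ⟨h0, hd⟩, hp, hq⟩

theorem finite_boundary_recolor (hw : Function.Injective fun k : Y × κ => w k.1 k.2)
    (hM : ∀ y, φ.IsReplacement (w y) M) (hreach : ∀ y p q, G.Reachable (w y p) (w y q)) {x : V}
    (hS : {e : V × V | G.Reachable x e.1 ∧ (patch hw hM).fracGraph.Adj e.1 e.2 ∧ e.1 ∈ S ∧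
      e.2 ∉ S}.Finite) :
    {e : V × V | G.Reachable x e.1 ∧ φ.fracGraph.Adj e.1 e.2 ∧ e.1 ∈ recolor φ w M S ∧
      e.2 ∉ recolor φ w M S}.Finite := by
  refine (hS.union ((finite_setOf_not_isPure hw hM hS).biUnion fun y _ =>
    (finite_range (w y)).prod (finite_range (w y)))).subset ?_
  rintro ⟨u, v⟩ ⟨hxu, huv, hu, hv⟩
  by_cases h : ∀ y, u ∈ range (w y) → v ∉ range (w y)
  · exact Or.inl ⟨hxu, (patch_fracGraph_adj_of_notMem_range hw hM h).2 huv,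
      (mem_recolor_iff_of_adj hw hM huv h).1 hu,
      fun hvS => hv ((mem_recolor_iff_of_adj hw hM huv.symm fun y hv hu => h y hu hv).2 hvS)⟩
  · push Not at h
    obtain ⟨y, ⟨p, rfl⟩, q, rfl⟩ := h
    refine Or.inr (mem_biUnion ⟨fun p' => hxu.trans (hreach y p p'), fun hpure => hv ?_⟩
      ⟨⟨p, rfl⟩, q, rfl⟩)
    rwa [mem_recolor_of_isPure hw hpure] at hu ⊢

theorem patch_almostOneEnded (hw : Function.Injective fun k : Y × κ => w k.1 k.2)
    (hM : ∀ y, φ.IsReplacement (w y) M) (hreach : ∀ y p q, G.Reachable (w y p) (w y q))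
    (hend : AlmostOneEnded G φ.fracGraph) : AlmostOneEnded G (patch hw hM).fracGraph := by
  intro x S hS
  have hinf : ∀ v, {t | (patch hw hM).fracGraph.Reachable v t}.Infinite →
      {t | φ.fracGraph.Reachable v t}.Infinite :=
    fun v hv => hv.mono fun t ht => ht.mono (patch_refines hw hM).fracGraph_le
  refine (hend x (recolor φ w M S) (finite_boundary_recolor hw hM hreach hS)).imp
    (fun h => h.subset ?_) (fun h => h.subset ?_)
  · rintro v ⟨hxv, hv, hvS⟩
    exact ⟨hxv, hinf v hv, (mem_recolor_iff_of_infinite hw hM hv).2 hvS⟩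
  · rintro v ⟨hxv, hv, hvS⟩
    exact ⟨hxv, hinf v hv, fun h => hvS ((mem_recolor_iff_of_infinite hw hM hv).1 h)⟩

end Recolor

end FractionalMatching

section Borel

variable {X : Type*} [MeasurableSpace X] [StandardBorelSpace X]

theorem exists_measurable_of_existsUnique {Z : Type*} [MeasurableSpace Z] [StandardBorelSpace Z]
    {R : X → Z → Prop} (hR : Measurable fun p : X × Z => R p.1 p.2) (h : ∀ x, ∃! z, R x z) :
    ∃ f : X → Z, Measurable f ∧ ∀ x, R x (f x) := by
  choose f hf using fun x => (h x).exists
  have := (measurableSet_setOfPred.2 hR).standardBorel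
  have fst_embedding : MeasurableEmbedding fun p : {p : X × Z | R p.1 p.2} => p.1.1 :=
    Measurable.measurableEmbedding (by fun_prop) fun p q hpq =>
      Subtype.ext (Prod.ext hpq ((h p.1.1).unique p.2 (hpq ▸ q.2)))
  refine ⟨f, ?_, hf⟩
  have graph_measurable : Measurable fun x => (⟨(x, f x), hf x⟩ : {p : X × Z | R p.1 p.2}) :=
    fst_embedding.measurable_comp_iff.1 measurable_id
  exact measurable_snd.comp (measurable_subtype_coe.comp graph_measurable)

theorem exists_countable_cover_eq_of_apply_mem {κ : Type*} [Finite κ] {f : κ → X → X}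
    (hf : ∀ k, Measurable (f k)) :
    ∃ 𝓑 : Set (Set X), 𝓑.Countable ∧ (∀ B ∈ 𝓑, MeasurableSet B) ∧ (∀ x, ∃ B ∈ 𝓑, x ∈ B) ∧
      ∀ B ∈ 𝓑, ∀ x ∈ B, ∀ k, f k x ∈ B → f k x = x := by
  let := upgradeStandardBorel X
  let sep (U : Set X) : Set X := {x | x ∈ U ∧ ∀ k, f k x ∈ U → f k x = x}
  refine ⟨sep '' TopologicalSpace.countableBasis X,
    (TopologicalSpace.countable_countableBasis X).image sep, ?_, fun x => ?_, ?_⟩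
  · rintro _ ⟨U, hU, rfl⟩
    have hUm : Measurable (· ∈ U) := measurableSet_setOfPred.1
      (TopologicalSpace.isOpen_of_mem_countableBasis hU).measurableSet
    exact measurableSet_setOfPred.2 <|
      hUm.and (.forall fun k => (hUm.comp (hf k)).imp (by fun_prop))
  · have hmoved : (range (fun k => f k x) \ {x}).Finite := (finite_range _).sdiff
    obtain ⟨U, hU, hxU, hUx⟩ :=
      (TopologicalSpace.isBasis_countableBasis X).exists_subset_of_mem_open (a := x)
        (u := (range (fun k => f k x) \ {x})ᶜ) (fun h => h.2 rfl) hmoved.isClosed.isOpen_compl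
    exact ⟨sep U, ⟨U, hU, rfl⟩, hxU, fun k hk => by_contra fun hne => hUx hk ⟨⟨k, rfl⟩, hne⟩⟩
  · rintro _ ⟨U, -, rfl⟩ x hx k hk
    exact hx.2 k hk.1

variable {G : SimpleGraph X} [G.LocallyFinite] {d : ℕ}

theorem exists_measurable_neighbors (hG : G.IsBorel) (hreg : G.IsRegularOfDegree d) :
    ∃ g : Fin d → X → X, (∀ i, Measurable (g i)) ∧ ∀ x y, G.Adj x y ↔ ∃ i, g i x = y := by
  classical
  obtain ⟨e, he⟩ := MeasureTheory.exists_measurableEmbedding_real X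
  have he' := he.measurable
  let : LinearOrder X := LinearOrder.lift' e he.injective
  have hcard : ∀ x, (G.neighborFinset x).card = d := fun x =>
    (SimpleGraph.card_neighborFinset_eq_degree ..).trans (hreg x)
  let Enumerates (x : X) (y : Fin d → X) : Prop := (∀ i, y i ∈ G.neighborFinset x) ∧ StrictMono y
  have enumerates_measurable : Measurable fun p : X × (Fin d → X) => Enumerates p.1 p.2 := by
    refine .and (.forall fun i => ?_) (.forall fun i => .forall fun j => .imp (by fun_prop) ?_)
    · simp only [SimpleGraph.mem_neighborFinset]
      exact (measurableSet_setOfPred.1 hG).comp (g := fun p : X × X => G.Adj p.1 p.2)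
        (f := fun p : X × (Fin d → X) => (p.1, p.2 i)) (by fun_prop)
    · exact measurableSet_setOfPred.1 (measurableSet_lt (f := fun p : X × (Fin d → X) => e (p.2 i))
        (g := fun p : X × (Fin d → X) => e (p.2 j)) (by fun_prop) (by fun_prop))
  obtain ⟨g, hg, hgx⟩ := exists_measurable_of_existsUnique enumerates_measurable fun x =>
    ⟨(G.neighborFinset x).orderEmbOfFin (hcard x),
      ⟨Finset.orderEmbOfFin_mem _ _, OrderEmbedding.strictMono _⟩,
      fun y hy => Finset.orderEmbOfFin_unique (hcard x) hy.1 hy.2⟩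
  refine ⟨fun i x => g x i, fun i => by fun_prop, fun x y => ?_⟩
  have himage : Finset.univ.image (g x) = G.neighborFinset x :=
    Finset.eq_of_subset_of_card_le (Finset.image_subset_iff.2 fun i _ => (hgx x).1 i) <| by
      rw [Finset.card_image_of_injective _ (hgx x).2.injective, hcard, Finset.card_fin]
  rw [← SimpleGraph.mem_neighborFinset, ← himage]
  simp

/-- The connected component of every vertex `x` of `G` consists of the values `T i x`. -/
def EnumeratesComponents {V ι : Type*} (G : SimpleGraph V) (T : ι → V → V) : Prop :=
  ∀ x y, G.Reachable x y ↔ ∃ i, T i x = y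

theorem EnumeratesComponents.reachable {V ι : Type*} {G : SimpleGraph V} {T : ι → V → V}
    (hT : EnumeratesComponents G T) (i : ι) (x : V) : G.Reachable x (T i x) :=
  (hT x _).2 ⟨i, rfl⟩

theorem exists_measurable_enumeratesComponents (hG : G.IsBorel) (hreg : G.IsRegularOfDegree d) :
    ∃ T : List (Fin d) → X → X, (∀ i, Measurable (T i)) ∧ EnumeratesComponents G T := by
  obtain ⟨g, hg, hadj⟩ := exists_measurable_neighbors hG hreg
  refine ⟨fun l x => l.foldl (fun z i => g i z) x, fun l => ?_, fun x y => ⟨?_, ?_⟩⟩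
  · induction l with
    | nil => exact measurable_id
    | cons i l ih => exact ih.comp (hg i)
  · rintro ⟨walk⟩
    induction walk with
    | nil => exact ⟨[], rfl⟩
    | cons h _ ih =>
      obtain ⟨i, rfl⟩ := (hadj _ _).1 h
      obtain ⟨l, hl⟩ := ih
      exact ⟨i :: l, hl⟩
  · rintro ⟨l, rfl⟩
    induction l generalizing x with
    | nil => exact .refl x
    | cons i l ih =>
      exact (SimpleGraph.Adj.reachable ((hadj x _).2 ⟨i, rfl⟩)).trans (ih (g i x))

end Borel

namespace FractionalMatching

section Measurability

variable {X Z ι κ : Type*} [MeasurableSpace X] [MeasurableSpace Z] {G : SimpleGraph X}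
  [G.LocallyFinite] {d : ℕ} {φ : FractionalMatching G d} {T : ι → X → X}

theorem measurable_weight (hφ : Measurable φ.weight.uncurry) {f g : Z → X} (hf : Measurable f)
    (hg : Measurable g) : Measurable fun z => φ.weight (f z) (g z) :=
  hφ.comp (hf.prodMk hg)

theorem measurable_fracGraph_adj (hφ : Measurable φ.weight.uncurry) {f g : Z → X}
    (hf : Measurable f) (hg : Measurable g) : Measurable fun z => φ.fracGraph.Adj (f z) (g z) := by
  have := measurable_weight hφ hf hg
  simp only [fracGraph_adj]
  fun_prop

variable [Countable ι]

theorem measurable_integralAt (hTm : ∀ i, Measurable (T i)) (hT : EnumeratesComponents G T)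
    (hφ : Measurable φ.weight.uncurry) : Measurable φ.IntegralAt := by
  have integralAt_iff : φ.IntegralAt = fun x => ∀ i, ¬ φ.fracGraph.Adj x (T i x) := by
    ext x
    refine ⟨fun h i => h _, fun h y hy => ?_⟩
    obtain ⟨i, rfl⟩ := (hT x y).1 (φ.fracGraph_le hy).reachable
    exact h i hy
  rw [integralAt_iff]
  exact .forall fun i => (measurable_fracGraph_adj hφ measurable_id (hTm i)).not

variable [StandardBorelSpace X] {w : Z → κ → X}

theorem measurable_isOuter [Countable κ] (hTm : ∀ i, Measurable (T i))
    (hT : EnumeratesComponents G T) (hφ : Measurable φ.weight.uncurry)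
    (hw : ∀ p, Measurable fun z => w z p) (p : κ) : Measurable fun z => φ.IsOuter (w z) p := by
  have isOuter_iff : ∀ z, φ.IsOuter (w z) p ↔
      ∃ i, (¬ ∃ q, w z q = T i (w z p)) ∧ φ.fracGraph.Adj (w z p) (T i (w z p)) := by
    refine fun z => ⟨?_, fun ⟨i, hi, hadj⟩ => ⟨_, hi, hadj⟩⟩
    rintro ⟨t, ht, hadj⟩
    obtain ⟨i, rfl⟩ := (hT _ t).1 (φ.fracGraph_le hadj).reachable
    exact ⟨i, ht, hadj⟩
  simp only [isOuter_iff]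
  have := fun i => measurable_fracGraph_adj hφ (hw p) ((hTm i).comp (hw p))
  have := fun i => (hTm i).comp (hw p)
  fun_prop

theorem measurable_isReplacement [Fintype κ] (hTm : ∀ i, Measurable (T i))
    (hT : EnumeratesComponents G T) (hφ : Measurable φ.weight.uncurry)
    (hw : ∀ p, Measurable fun z => w z p) (M : κ → κ → ℤ) :
    Measurable fun z => φ.IsReplacement (w z) M := by
  have isReplacement_iff : ∀ z, φ.IsReplacement (w z) M ↔ (∀ p q, M p q = M q p) ∧
      (∀ p q, 0 ≤ M p q) ∧
      (∀ p q, ¬ φ.fracGraph.Adj (w z p) (w z q) → M p q = φ.weight (w z p) (w z q)) ∧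
      (∀ p, ∑ q, M p q = ∑ q, φ.weight (w z p) (w z q)) ∧
      ∀ p q, φ.IsOuter (w z) p → φ.IsOuter (w z) q →
        Relation.ReflTransGen (fun i j => M i j ≠ 0 ∧ M i j ≠ d) p q :=
    fun z => ⟨fun h => ⟨h.symm, h.nonneg, h.eq_of_not_adj, h.sum_eq, h.reflTransGen_of_isOuter⟩,
      fun ⟨h₁, h₂, h₃, h₄, h₅⟩ => ⟨h₁, h₂, h₃, h₄, h₅⟩⟩
  simp only [isReplacement_iff]
  have := fun p q => measurable_fracGraph_adj hφ (hw p) (hw q)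
  have := fun p q => measurable_weight hφ (hw p) (hw q)
  have := measurable_isOuter hTm hT hφ hw
  fun_prop

end Measurability

theorem measurable_patch {X Y κ : Type*} [MeasurableSpace X] [StandardBorelSpace X]
    [MeasurableSpace Y] [StandardBorelSpace Y] [Fintype κ] {G : SimpleGraph X} [G.LocallyFinite]
    {d : ℕ} {φ : FractionalMatching G d} (hφ : Measurable φ.weight.uncurry) {w : Y → κ → X}
    {M : κ → κ → ℤ} (hw : Function.Injective fun k : Y × κ => w k.1 k.2)
    (hM : ∀ y, φ.IsReplacement (w y) M) (hwm : ∀ p, Measurable fun y => w y p) :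
    Measurable (patch hw hM).weight.uncurry := by
  let : MeasurableSpace κ := ⊤
  have : DiscreteMeasurableSpace κ := ⟨fun _ => trivial⟩
  have window_measurable : Measurable fun k : Y × κ => w k.1 k.2 :=
    measurable_from_prod_countable_left hwm
  have window_embedding : MeasurableEmbedding
      fun k : Y × κ × κ => (w k.1 k.2.1, w k.1 k.2.2) :=
    Measurable.measurableEmbedding (by fun_prop) (injective_window_pair hw)
  have matrix_measurable : Measurable fun m : κ × κ => M m.1 m.2 := .of_discrete
  exact window_embedding.measurable_extend (matrix_measurable.comp measurable_snd) hφ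

section Refinements

variable {X ι : Type*} {G : SimpleGraph X} [G.LocallyFinite] {d : ℕ} {φ : FractionalMatching G d}
  {T : ι → X → X}

/-- The window `p ↦ T (a p) y` around `y`, with `y` at position `c`, admits the replacement matrix
`M`, and this makes the fractional perfect matching integral at `y`. Each `r p` leads back from
position `p` to `y`, so that `y` can be recovered from every vertex of the window. -/
structure Fits {κ : Type*} [Fintype κ] (T : ι → X → X) (φ : FractionalMatching G d)
    (a r : κ → ι) (c : κ) (M : κ → κ → ℤ) (y : X) : Prop where
  injective : Function.Injective fun p => T (a p) y
  return_eq : ∀ p, T (r p) (T (a p) y) = y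
  center_eq : T (a c) y = y
  isReplacement : φ.IsReplacement (fun p => T (a p) y) M
  not_isOuter : ¬ φ.IsOuter (fun p => T (a p) y) c
  eq_zero_or_eq : ∀ q, M c q = 0 ∨ M c q = d

theorem exists_fits (hT : EnumeratesComponents G T) (hbip : G.IsBipartite)
    (φ : FractionalMatching G d) (hend : AlmostOneEnded G φ.fracGraph) (y : X) :
    ∃ (n : ℕ) (a r : Fin n → ι) (c : Fin n) (M : Fin n → Fin n → ℤ), Fits T φ a r c M y := by
  obtain ⟨n, w, M, c, hw, hM, hc, hreach, houter, hMc⟩ := exists_isReplacement φ hbip hend y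
  choose a ha using fun p => (hT y (w p)).1 (hreach p)
  choose r hr using fun p => (hT (w p) y).1 (hreach p).symm
  obtain rfl : w = fun p => T (a p) y := funext fun p => (ha p).symm
  exact ⟨n, a, r, c, M, hw, hr, hc, hM, houter, hMc⟩

/-- The invariant of the construction: the weights are Borel and the graph of fractional edges is
almost one-ended. -/
structure IsBorelAlmostOneEnded [MeasurableSpace X] (φ : FractionalMatching G d) : Prop where
  measurable : Measurable φ.weight.uncurry
  almostOneEnded : AlmostOneEnded G φ.fracGraph

variable [MeasurableSpace X] [StandardBorelSpace X]

theorem exists_refines_of_fits (hTm : ∀ i, Measurable (T i)) (hT : EnumeratesComponents G T)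
    (hφ : φ.IsBorelAlmostOneEnded) {κ : Type*} [Fintype κ] {a r : κ → ι} {c : κ}
    {M : κ → κ → ℤ} {A : Set X} (hA : MeasurableSet A) (hfits : ∀ y ∈ A, Fits T φ a r c M y)
    (hsep : ∀ y ∈ A, ∀ p q, T (r q) (T (a p) y) ∈ A → T (r q) (T (a p) y) = y) :
    ∃ ψ : FractionalMatching G d, ψ.IsBorelAlmostOneEnded ∧ ψ.Refines φ ∧
      ∀ y ∈ A, ψ.IntegralAt y := by
  have := hA.standardBorel
  let w (y : A) (p : κ) : X := T (a p) y
  have hM (y : A) : φ.IsReplacement (w y) M := (hfits y y.2).isReplacement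
  have hw : Function.Injective fun k : A × κ => w k.1 k.2 := by
    rintro ⟨y, p⟩ ⟨y', q⟩ (h : T (a p) y = T (a q) y')
    have hreturn : T (r q) (T (a p) y) = y' := by rw [h, (hfits y' y'.2).return_eq]
    obtain rfl : y = y' :=
      Subtype.ext ((hsep y y.2 p q (hreturn ▸ y'.2)).symm.trans hreturn)
    rw [(hfits y y.2).injective h]
  refine ⟨patch hw hM, ⟨?_, ?_⟩, patch_refines hw hM, fun y hy => ?_⟩
  · exact measurable_patch hφ.measurable hw hM fun p => (hTm _).comp measurable_subtype_coe
  · exact patch_almostOneEnded hw hM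
      (fun y p q => (hT.reachable (a p) _).symm.trans (hT.reachable (a q) _)) hφ.almostOneEnded
  · have := patch_integralAt hw hM (y := ⟨y, hy⟩) (hfits y hy).not_isOuter
      (hfits y hy).eq_zero_or_eq
    rwa [show w ⟨y, hy⟩ c = y from (hfits y hy).center_eq] at this

variable [Countable ι]

theorem measurable_fits (hTm : ∀ i, Measurable (T i)) (hT : EnumeratesComponents G T)
    (hφ : Measurable φ.weight.uncurry) {κ : Type*} [Fintype κ] (a r : κ → ι) (c : κ)
    (M : κ → κ → ℤ) : Measurable (Fits T φ a r c M) := by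
  have fits_iff : Fits T φ a r c M = fun y => (∀ p q, T (a p) y = T (a q) y → p = q) ∧
      (∀ p, T (r p) (T (a p) y) = y) ∧ T (a c) y = y ∧
      φ.IsReplacement (fun p => T (a p) y) M ∧ ¬ φ.IsOuter (fun p => T (a p) y) c ∧
      ∀ q, M c q = 0 ∨ M c q = d := by
    ext y
    exact ⟨fun h => ⟨fun _ _ he => h.injective he, h.return_eq, h.center_eq, h.isReplacement,
      h.not_isOuter, h.eq_zero_or_eq⟩, fun ⟨h₁, h₂, h₃, h₄, h₅, h₆⟩ =>
      ⟨h₁, h₂, h₃, h₄, h₅, h₆⟩⟩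
  rw [fits_iff]
  have := measurable_isReplacement hTm hT hφ (w := fun y p => T (a p) y) (fun p => hTm _) M
  have := measurable_isOuter hTm hT hφ (w := fun y p => T (a p) y) (fun p => hTm _) c
  have := fun p => (hTm (r p)).comp (hTm (a p))
  fun_prop

theorem exists_countable_refinements_of_fits (hTm : ∀ i, Measurable (T i))
    (hT : EnumeratesComponents G T) (hφ : φ.IsBorelAlmostOneEnded) {κ : Type*} [Fintype κ]
    (a r : κ → ι) (c : κ) (M : κ → κ → ℤ) :
    ∃ Ψ : Set (FractionalMatching G d), Ψ.Countable ∧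
      (∀ ψ ∈ Ψ, ψ.IsBorelAlmostOneEnded ∧ ψ.Refines φ) ∧
      ∀ y, Fits T φ a r c M y → ∃ ψ ∈ Ψ, ψ.IntegralAt y := by
  obtain ⟨𝓑, h𝓑, hmeas, hcover, hsep⟩ := exists_countable_cover_eq_of_apply_mem
    (f := fun (k : κ × κ) y => T (r k.2) (T (a k.1) y)) fun k => (hTm _).comp (hTm _)
  have := h𝓑.to_subtype
  choose ψ hψ hψφ hint using fun B : 𝓑 => exists_refines_of_fits hTm hT hφ
    ((hmeas B B.2).inter (measurableSet_setOfPred.2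
      (measurable_fits hTm hT hφ.measurable a r c M)))
    (fun y hy => hy.2) (fun y hy p q h => hsep B B.2 y hy.1 (p, q) h.1)
  refine ⟨range ψ, countable_range ψ, forall_mem_range.2 fun B => ⟨hψ B, hψφ B⟩, fun y hy => ?_⟩
  obtain ⟨B, hB, hyB⟩ := hcover y
  exact ⟨_, mem_range_self ⟨B, hB⟩, hint ⟨B, hB⟩ y ⟨hyB, hy⟩⟩

theorem exists_countable_refinements (hTm : ∀ i, Measurable (T i))
    (hT : EnumeratesComponents G T) (hbip : G.IsBipartite) (hφ : φ.IsBorelAlmostOneEnded) :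
    ∃ Ψ : Set (FractionalMatching G d), Ψ.Countable ∧
      (∀ ψ ∈ Ψ, ψ.IsBorelAlmostOneEnded ∧ ψ.Refines φ) ∧ ∀ y, ∃ ψ ∈ Ψ, ψ.IntegralAt y := by
  choose Ψ hcount hΨ hint using fun k : (n : ℕ) ×
      (Fin n → ι) × (Fin n → ι) × Fin n × (Fin n → Fin n → ℤ) =>
    exists_countable_refinements_of_fits hTm hT hφ k.2.1 k.2.2.1 k.2.2.2.1 k.2.2.2.2
  refine ⟨⋃ k, Ψ k, countable_iUnion hcount, fun ψ hψ => ?_, fun y => ?_⟩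
  · obtain ⟨k, hk⟩ := mem_iUnion.1 hψ
    exact hΨ k ψ hk
  · obtain ⟨n, a, r, c, M, hfits⟩ := exists_fits hT hbip φ hφ.almostOneEnded y
    obtain ⟨ψ, hψ, hψy⟩ := hint ⟨n, a, r, c, M⟩ y hfits
    exact ⟨ψ, mem_iUnion.2 ⟨_, hψ⟩, hψy⟩

end Refinements

end FractionalMatching

theorem mem_residual_of_not_isMeagre_inter {X : Type*} [TopologicalSpace X] {𝓑 : Set (Set X)}
    (h𝓑 : TopologicalSpace.IsTopologicalBasis 𝓑) {R : Set X} (hR : BaireMeasurableSet R)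
    (h : ∀ U ∈ 𝓑, U.Nonempty → ¬ IsMeagre (U ∩ R)) : R ∈ residual X := by
  obtain ⟨O, hO, hRO⟩ := hR.compl.residualEq_isOpen
  obtain rfl : O = ∅ := by
    by_contra hne
    obtain ⟨x, hx⟩ := nonempty_iff_ne_empty.2 hne
    obtain ⟨U, hU, hxU, hUO⟩ := h𝓑.exists_subset_of_mem_open hx hO
    refine h U hU ⟨x, hxU⟩ ?_
    filter_upwards [hRO.mem_iff] with z hz hzUR
    exact hz.2 (hUO hzUR.1) hzUR.2
  filter_upwards [hRO.mem_iff] with z hz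
  exact not_not.1 fun hzR => hz.1 hzR

namespace FractionalMatching

section Category

variable {X ι : Type*} [MeasurableSpace X] {G : SimpleGraph X}
  [G.LocallyFinite] {d : ℕ} {φ : FractionalMatching G d}

theorem hasBorelPerfectMatching_induce (hd : d ≠ 0) {Φ : ℕ → FractionalMatching G d}
    (hΦ : ∀ n, Measurable (Φ n).weight.uncurry) (hrefines : ∀ m n, m ≤ n → (Φ n).Refines (Φ m))
    {Y : Set X} (hY : G.IsInvariantSet Y) (hint : ∀ x ∈ Y, ∃ n, (Φ n).IntegralAt x) :
    (G.induce Y).HasBorelPerfectMatching := by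
  have adj_of_eq {x y n} (h : (Φ n).weight x y = d) : G.Adj x y :=
    (Φ n).adj_of_ne x y (by simpa [h] using hd)
  have eq_of_le {m n x y} (hmn : m ≤ n) (h : (Φ m).weight x y = d) : (Φ n).weight x y = d :=
    (hrefines m n hmn x y fun hfrac => hfrac.2 h).trans h
  let M : (G.induce Y).Subgraph :=
    { verts := univ
      Adj := fun x y => ∃ n, (Φ n).weight x y = d
      adj_sub := fun ⟨_, h⟩ => adj_of_eq h
      edge_vert := fun _ => mem_univ _
      symm := ⟨fun x y ⟨n, h⟩ => ⟨n, ((Φ n).symm y x).trans h⟩⟩ }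
  refine ⟨M, ⟨fun x _ => ?_, mem_univ⟩, ?_⟩
  · obtain ⟨n, hn⟩ := hint x x.2
    obtain ⟨y, hy, -⟩ := hn.existsUnique_weight_eq hd
    refine ⟨⟨y, hY (adj_of_eq hy).reachable x.2⟩, ⟨n, hy⟩, ?_⟩
    rintro z ⟨m, hm⟩
    have hmax := hn.of_refines (hrefines n (max m n) (le_max_right m n))
    exact Subtype.ext <| (hmax.existsUnique_weight_eq hd).unique
      (eq_of_le (le_max_left m n) hm) (eq_of_le (le_max_right m n) hy)
  · have weight_measurable n : Measurable fun p : Y × Y => (Φ n).weight p.1 p.2 :=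
      measurable_weight (hΦ n) (by fun_prop) (by fun_prop)
    exact measurableSet_setOfPred.2 (.exists fun n => (weight_measurable n).eq measurable_const)

variable [StandardBorelSpace X] [TopologicalSpace X] [BaireSpace X] [Countable ι] {T : ι → X → X}

theorem exists_refines_not_isMeagre (hTm : ∀ i, Measurable (T i))
    (hT : EnumeratesComponents G T) (hbip : G.IsBipartite) (hφ : φ.IsBorelAlmostOneEnded)
    (f : X → X) {U : Set X} (hU : IsOpen U) (hne : U.Nonempty) :
    ∃ ψ : FractionalMatching G d, ψ.IsBorelAlmostOneEnded ∧ ψ.Refines φ ∧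
      ¬ IsMeagre (U ∩ {x | ψ.IntegralAt (f x)}) := by
  obtain ⟨Ψ, hcount, hΨ, hint⟩ := exists_countable_refinements hTm hT hbip hφ
  by_contra! hmeagre
  have union_meagre : IsMeagre (⋃ ψ ∈ Ψ, U ∩ {x | ψ.IntegralAt (f x)}) :=
    isMeagre_biUnion hcount fun ψ hψ => hmeagre ψ (hΨ ψ hψ).1 (hΨ ψ hψ).2
  refine not_isMeagre_of_isOpen hU hne (union_meagre.mono fun x hx => ?_)
  obtain ⟨ψ, hψ, hψx⟩ := hint (f x)
  exact mem_biUnion hψ ⟨hx, hψx⟩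

theorem exists_seq_integralAt_mem_residual [SecondCountableTopology X] [BorelSpace X]
    (hTm : ∀ i, Measurable (T i)) (hT : EnumeratesComponents G T) (hbip : G.IsBipartite)
    (hφ : φ.IsBorelAlmostOneEnded) :
    ∃ Φ : ℕ → FractionalMatching G d, (∀ n, Measurable (Φ n).weight.uncurry) ∧
      (∀ m n, m ≤ n → (Φ n).Refines (Φ m)) ∧
      ∀ i, {x | ∃ n, (Φ n).IntegralAt (T i x)} ∈ residual X := by
  let 𝓑 := TopologicalSpace.countableBasis X
  have h𝓑 : TopologicalSpace.IsTopologicalBasis 𝓑 := TopologicalSpace.isBasis_countableBasis X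
  have := (TopologicalSpace.countable_countableBasis X).to_subtype
  let State := {ψ : FractionalMatching G d // ψ.IsBorelAlmostOneEnded}
  -- `none` is a task with nothing to do: without it there is no task at all if `X` is empty.
  obtain ⟨task, htask⟩ := exists_surjective_nat (Option (ι × 𝓑))
  have exists_next (o : Option (ι × 𝓑)) (ψ : State) : ∃ χ : State, χ.1.Refines ψ.1 ∧
      ∀ i U, o = some (i, U) → ¬ IsMeagre ((U : Set X) ∩ {x | χ.1.IntegralAt (T i x)}) := by
    obtain _ | ⟨i, U⟩ := o
    · exact ⟨ψ, .refl _, by simp⟩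
    · obtain ⟨χ, hχ, hχψ, hU⟩ := exists_refines_not_isMeagre hTm hT hbip ψ.2 (T i)
        (h𝓑.isOpen U.2) (TopologicalSpace.nonempty_of_mem_countableBasis U.2)
      refine ⟨⟨χ, hχ⟩, hχψ, ?_⟩
      rintro _ _ ⟨⟩
      exact hU
  choose next hrefines hnext using exists_next
  let Φ (n : ℕ) : State := Nat.rec ⟨φ, hφ⟩ (fun m ψ => next (task m) ψ) n
  refine ⟨fun n => (Φ n).1, fun n => (Φ n).2.measurable, fun m n hmn => ?_, fun i => ?_⟩
  · exact Nat.le_induction (.refl _) (fun k _ ih => (hrefines (task k) (Φ k)).trans ih) n hmn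
  · have integral_measurable : Measurable fun x => ∃ n, (Φ n).1.IntegralAt (T i x) :=
      .exists fun n => (measurable_integralAt hTm hT (Φ n).2.measurable).comp (hTm i)
    refine mem_residual_of_not_isMeagre_inter h𝓑
      (measurableSet_setOfPred.2 integral_measurable).baireMeasurableSet fun U hU _ hmeagre => ?_
    obtain ⟨n, hn⟩ := htask (some (i, ⟨U, hU⟩))
    have hsubset : {x | (Φ (n + 1)).1.IntegralAt (T i x)} ⊆ {x | ∃ n, (Φ n).1.IntegralAt (T i x)} :=
      fun x hx => ⟨n + 1, hx⟩
    exact hnext (task n) (Φ n) i ⟨U, hU⟩ hn (hmeagre.mono (inter_subset_inter_right U hsubset))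

end Category

theorem exists_hasBorelPerfectMatching_induce {X ι : Type*} [TopologicalSpace X]
    [SecondCountableTopology X] [BaireSpace X] [MeasurableSpace X] [BorelSpace X]
    [StandardBorelSpace X] [Countable ι] {G : SimpleGraph X} [G.LocallyFinite] {d : ℕ}
    {φ : FractionalMatching G d} {T : ι → X → X} (hTm : ∀ i, Measurable (T i))
    (hT : EnumeratesComponents G T) (hbip : G.IsBipartite) (hd : d ≠ 0)
    (hφ : φ.IsBorelAlmostOneEnded) :
    ∃ Y : Set X, MeasurableSet Y ∧ Y ∈ residual X ∧ G.IsInvariantSet Y ∧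
      (G.induce Y).HasBorelPerfectMatching := by
  obtain ⟨Φ, hΦ, hrefines, hresidual⟩ := exists_seq_integralAt_mem_residual hTm hT hbip hφ
  let Y : Set X := ⋂ i, {x | ∃ n, (Φ n).IntegralAt (T i x)}
  have mem_Y {x} : x ∈ Y ↔ ∀ y, G.Reachable x y → ∃ n, (Φ n).IntegralAt y := by
    simp [Y, hT x]
  have hY : G.IsInvariantSet Y := fun x y hxy hx =>
    mem_Y.2 fun z hyz => mem_Y.1 hx z (hxy.trans hyz)
  refine ⟨Y, .iInter fun i => measurableSet_setOfPred.2 ?_, countable_iInter_mem.2 hresidual, hY,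
    hasBorelPerfectMatching_induce hd hΦ hrefines hY fun x hx => mem_Y.1 hx x (.refl x)⟩
  exact .exists fun n => (measurable_integralAt hTm hT (hΦ n)).comp (hTm i)

section Uniform

variable {V : Type*} {G : SimpleGraph V} [G.LocallyFinite] {d : ℕ}

open Classical in
/-- The uniform fractional perfect matching of a `d`-regular graph; recall that weights are scaled
by `d`. -/
noncomputable def uniform (hreg : G.IsRegularOfDegree d) : FractionalMatching G d where
  weight a b := if G.Adj a b then 1 else 0
  symm a b := by simp only [G.adj_comm]
  adj_of_ne a b h := by simpa using h
  nonneg a b := by split_ifs <;> simp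
  sum_eq a := by
    rw [Finset.sum_congr rfl fun b hb => if_pos ((G.mem_neighborFinset a b).1 hb)]
    simp [hreg a]

theorem uniform_fracGraph_adj (hreg : G.IsRegularOfDegree d) {a b : V} :
    (uniform hreg).fracGraph.Adj a b ↔ G.Adj a b ∧ d ≠ 1 := by
  by_cases h : G.Adj a b <;> simp [fracGraph_adj, uniform, h, eq_comm]

theorem almostOneEnded_uniform (hreg : G.IsRegularOfDegree d)
    (hend : ∀ C : G.ConnectedComponent, HasAtMostOneEnd C.toSimpleGraph) :
    AlmostOneEnded G (uniform hreg).fracGraph := by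
  obtain rfl | hd := eq_or_ne d 1
  · rw [show (uniform hreg).fracGraph = ⊥ by ext; simp [uniform_fracGraph_adj]]
    exact .bot G
  · rw [show (uniform hreg).fracGraph = G by ext; simp [uniform_fracGraph_adj, hd]]
    exact .self hend

theorem measurable_uniform [MeasurableSpace V] (hG : G.IsBorel) (hreg : G.IsRegularOfDegree d) :
    Measurable (uniform hreg).weight.uncurry :=
  Measurable.ite (p := fun z : V × V => G.Adj z.1 z.2) hG measurable_const measurable_const

end Uniform

end FractionalMatching

theorem theorem1p2_general {X : Type*} [TopologicalSpace X] [SecondCountableTopology X]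
    [BaireSpace X] [MeasurableSpace X] [BorelSpace X] [StandardBorelSpace X] (G : SimpleGraph X)
    [G.LocallyFinite] (d : ℕ) (hd : d ≠ 0) (hBorel : G.IsBorel) (hbip : G.IsBipartite)
    (hend : ∀ C : G.ConnectedComponent, HasAtMostOneEnd C.toSimpleGraph)
    (hreg : G.IsRegularOfDegree d) :
    ∃ Y : Set X, MeasurableSet Y ∧ Y ∈ residual X ∧ G.IsInvariantSet Y ∧
      (G.induce Y).HasBorelPerfectMatching := by
  obtain ⟨T, hTm, hT⟩ := exists_measurable_enumeratesComponents hBorel hreg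
  exact FractionalMatching.exists_hasBorelPerfectMatching_induce hTm hT hbip hd
    ⟨FractionalMatching.measurable_uniform hBorel hreg,
      FractionalMatching.almostOneEnded_uniform hreg hend⟩

theorem exists_ne_zero_isRegularOfDegree {V : Type*} {G : SimpleGraph V} [G.LocallyFinite] {d : ℕ}
    (hend : G.IsOneEnded) (hreg : G.IsRegularOfDegree d) :
    ∃ k ≠ 0, G.IsRegularOfDegree k := by
  obtain _ | ⟨⟨x⟩⟩ := isEmpty_or_nonempty V
  · exact ⟨1, one_ne_zero, isEmptyElim⟩
  · exact ⟨d, hreg x ▸ degree_ne_zero_of_isOneEnded hend x, hreg⟩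

theorem theorem1p2 {X : Type*} [TopologicalSpace X] [PolishSpace X] [MeasurableSpace X]
    [BorelSpace X] (G : SimpleGraph X) [G.LocallyFinite] (d : ℕ)
    (hBorel : G.IsBorel) (hbip : G.IsBipartite) (hend : G.IsOneEnded)
    (hreg : G.IsRegularOfDegree d) :
    ∃ Y : Set X, MeasurableSet Y ∧ Y ∈ residual X ∧ G.IsInvariantSet Y ∧
      (G.induce Y).HasBorelPerfectMatching := by
  obtain ⟨k, hk, hregk⟩ := exists_ne_zero_isRegularOfDegree hend hreg
  exact theorem1p2_general G k hk hBorel hbip (fun C => .of_hasOneEnd (hend C)) hregk
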